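/- Let $d\ge 9$. For a probability distribution $P$ on $\mathbb R^d$, a real number $\tau>0$ and a pair of coordinates $i^*<j^*$, consider the conditions 1. $\mathbb E[x_i^2]=1$ for all $i$; 2. $\mathbb E[x_{i^*}x_{j^*}]=\tau$, and $\mathbb E[x_ix_j]=0$ for all $i<j$ with $(i,j)\ne(i^*,j^*)$; 3. (concentration at sample size $m$) for all $i<j$, if $\widetilde{x_ix_j}$ denotes the empirical average of $x_ix_j$ over $m$ i.i.d. instances from $P$, then $\Pr\left(|\widetilde{x_ix_j}-\mathbb E[x_ix_j]|\ge \tau/2\right)\le 2\exp(-m\tau^2/6)$. A $(b,n,m)$ protocol receives $m$ successive independent batches $X^1,\dots,X^m$, each of $n$ i.i.d. instances; in round $t$ it computes a message $W^t=f_t(X^t,W^1,\dots,W^{t-1})$ of at most $b$ bits, and it finally returns $f(W^1,\dots,W^m)$. A $b$-memory online protocol over $m$ instances $x^1,\dots,x^m$ keeps a state $W^t=f_t(x^t,W^{t-1})$ of at most $b$ bits and finally returns $f(W^m)$. In both cases the functions are arbitrary and may be randomized (using randomness independent of the data). Then the following holds. (a) Let $(\tilde I,\tilde J)$ be a pair $i<j$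 maximizing $\widetilde{x_ix_j}$ over $m$ i.i.d. instances (ties broken arbitrarily). For every $P$ satisfying 1, 2, and 3 at sample size $m$, $$\Pr\left((\tilde I,\tilde J)=(i^*,j^*)\right)\ge 1-d^2\exp(-m\tau^2/6).$$ In particular, for all $c_1,c_2>0$ there is $\kappa>0$, depending only on $c_1,c_2$, such that if $\frac{c_1}{d\log d}\le\tau\le\frac{c_2}{d\log d}$, then this probability is at least $1-d^2\exp\left(-\kappa\,\frac{m}{d^2\log^2 d}\right)$. (b) There are universal constants $c_1,c_2,C>0$ such that for every $d\ge 9$ there is a value $\tau$ with $\frac{c_1}{d\log d}\le\tau\le\frac{c_2}{d\log d}$ for which the following holds for all integers $b,m\ge 0$: for every estimate $(\tilde I,\tilde J)$ returned by a $b$-memory online protocol over $m$ instances, and for every estimate $(\tilde I,\tilde J)$ returned by a $\left(b,\,d(d-1),\,\left\lfloor \frac{m}{d(d-1)}\right\rfloor\right)$ protocol, there are a pair $i^*<j^*$ and a distribution $P$ satisfying 1, 2 with this $\tau$, and 3 at every sample size, such that $$\Pr\left((\tilde I,\tilde J)=(i^*,j^*)\right)\le C\left(\frac1{d^2}+\sqrt{\frac{mb}{d^4}}\right).$$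 -/

import Mathlib

open MeasureTheory

universe u

namespace SparsePCA

noncomputable section

/-- A sample of `m` vectors in `ℝ^d`. -/
abbrev Sample (m d : ℕ) : Type := Fin m → Fin d → ℝ

/-- The law of `m` i.i.d. instances drawn from `P`. -/
abbrev iidLaw {d : ℕ} (P : Measure (Fin d → ℝ)) (m : ℕ) : Measure (Sample m d) :=
  Measure.pi fun _ => P

/-- The empirical average of `x_i x_j` over the sample `x`. -/
def empAvg {m d : ℕ} (x : Sample m d) (i j : Fin d) : ℝ :=
  (∑ t, x t i * x t j) / (m : ℝ)

/-- `P` is a distribution on `ℝ^d` with unit second moments, whose coordinates are uncorrelated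
except for the pair `p = (i⋆, j⋆)`, `i⋆ < j⋆`, which has correlation `τ > 0`.
(The second moments are nonzero integrals, so the squares `x_i ^ 2`, and hence the products
`x_i x_j`, are integrable.) -/
structure IsPairCorrelated {d : ℕ} (P : Measure (Fin d → ℝ)) (τ : ℝ) (p : Fin d × Fin d) :
    Prop where
  isProbabilityMeasure : IsProbabilityMeasure P
  second_moment : ∀ i, ∫ x, x i ^ 2 ∂P = 1
  ordered : p.1 < p.2
  pos : 0 < τ
  correlated : ∫ x, x p.1 * x p.2 ∂P = τ
  uncorrelated : ∀ i j, i < j → (i, j) ≠ p → ∫ x, x i * x j ∂P = 0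

/-- For every `i < j`, the empirical average of `x_i x_j` over `m` i.i.d. instances satisfies
`Pr(|avg - E[x_i x_j]| ≥ τ / 2) ≤ 2 exp(-m τ² / 6)`. -/
def Concentrates {d : ℕ} (m : ℕ) (P : Measure (Fin d → ℝ)) (τ : ℝ) : Prop :=
  ∀ i j : Fin d, i < j →
    (iidLaw P m).real {x | τ / 2 ≤ |empAvg x i j - ∫ y, y i * y j ∂P|} ≤
      2 * Real.exp (-((m : ℝ) * τ ^ 2 / 6))

/-- A plug-in estimator: it returns a pair `i < j` that maximizes the empirical average of
`x_i x_j` over all pairs `i < j`, with ties broken arbitrarily. -/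
def IsPlugIn {m d : ℕ} (est : Sample m d → Fin d × Fin d) : Prop :=
  ∀ x, (est x).1 < (est x).2 ∧
    ∀ i j, i < j → empAvg x i j ≤ empAvg x (est x).1 (est x).2

/-- `τ` lies between `c₁ / (d log d)` and `c₂ / (d log d)`. -/
def BiasOfOrder (c₁ c₂ : ℝ) (d : ℕ) (τ : ℝ) : Prop :=
  c₁ / ((d : ℝ) * Real.log d) ≤ τ ∧ τ ≤ c₂ / ((d : ℝ) * Real.log d)

/-- Messages of at most `b` bits. -/
def Message (b : ℕ) : Type := {l : List Bool // l.length ≤ b}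

instance (b : ℕ) : MeasurableSpace (Message b) := ⊤

/-- A (randomized) `(b, n, m)` protocol estimating a pair of coordinates from `m` batches of `n`
vectors in `ℝ^d`. The element `ω : Ω` is the random seed of the algorithm. In round `t` the
protocol sends a message of at most `b` bits, computed from the `t`-th batch and the previous
messages; its output is computed from the messages. -/
structure Protocol (Ω : Type u) [MeasurableSpace Ω] (b n m d : ℕ) where
  msg : (t : Fin m) → Ω → Sample n d → (Fin t → Message b) → Message b
  out : Ω → (Fin m → Message b) → Fin d × Fin d
  measurable_msg : ∀ t : Fin m, Measurable fun z : Ω × Sample n d × (Fin t → Message b) =>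
    msg t z.1 z.2.1 z.2.2
  measurable_out : Measurable fun z : Ω × (Fin m → Message b) => out z.1 z.2

namespace Protocol

variable {Ω : Type u} [MeasurableSpace Ω] {b n m d : ℕ}

/-- The first `t` messages, when run with seed `ω` on the batches `X`. -/
def transcript (A : Protocol Ω b n m d) (ω : Ω) (X : Fin m → Sample n d) :
    (t : ℕ) → t ≤ m → Fin t → Message b
  | 0, _ => Fin.elim0
  | t + 1, h =>
      Fin.snoc (α := fun _ => Message b) (A.transcript ω X t (Nat.le_of_succ_le h))
        (A.msg ⟨t, h⟩ ω (X ⟨t, h⟩) (A.transcript ω X t (Nat.le_of_succ_le h)))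

/-- The estimate returned, when run with seed `ω` on the batches `X`. -/
def estimate (A : Protocol Ω b n m d) (ω : Ω) (X : Fin m → Sample n d) : Fin d × Fin d :=
  A.out ω (A.transcript ω X m le_rfl)

/-- The probability that the estimate equals `p`, when the `m * n` instances are i.i.d. with
law `P` and the seed is independent of them with law `ν`. -/
def successProb (A : Protocol Ω b n m d) (ν : Measure Ω) (P : Measure (Fin d → ℝ))
    (p : Fin d × Fin d) : ℝ :=
  (ν.prod (Measure.pi fun _ : Fin m => iidLaw P n)).real {z | A.estimate z.1 z.2 = p}

end Protocol

/-- A (randomized) `b`-memory online protocol over `m` instances in `ℝ^d`: it keeps a state of at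
most `b` bits, which at step `t` is updated from the `t`-th instance and the current state only;
its output is computed from the final state. -/
structure OnlineProtocol (Ω : Type u) [MeasurableSpace Ω] (b m d : ℕ) where
  init : Ω → Message b
  update : Fin m → Ω → (Fin d → ℝ) → Message b → Message b
  out : Ω → Message b → Fin d × Fin d
  measurable_init : Measurable init
  measurable_update : ∀ t : Fin m, Measurable fun z : Ω × (Fin d → ℝ) × Message b =>
    update t z.1 z.2.1 z.2.2
  measurable_out : Measurable fun z : Ω × Message b => out z.1 z.2

namespace OnlineProtocol

variable {Ω : Type u} [MeasurableSpace Ω] {b m d : ℕ}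

/-- The estimate returned, when run with seed `ω` on the instances `x`. -/
def estimate (A : OnlineProtocol Ω b m d) (ω : Ω) (x : Sample m d) : Fin d × Fin d :=
  A.out ω (Fin.foldl m (fun w t => A.update t ω (x t) w) (A.init ω))

/-- The probability that the estimate equals `p`, when the `m` instances are i.i.d. with law `P`
and the seed is independent of them with law `ν`. -/
def successProb (A : OnlineProtocol Ω b m d) (ν : Measure Ω) (P : Measure (Fin d → ℝ))
    (p : Fin d × Fin d) : ℝ :=
  (ν.prod (iidLaw P m)).real {z | A.estimate z.1 z.2 = p}

end OnlineProtocol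

end

end SparsePCA

/-! Upper bound. If no empirical average deviates by τ/2, the average of the correlated pair exceeds
τ/2 and all others lie below τ/2; a union bound over the pairs gives (a) (`plugIn_success`).

Lower bound. The hard vector is √(d/2)(e_i ± e_j), with (i, j) uniform among N = d² locations and a
fair sign, except for a bias ρ = 1/(8 log d) at the location p; then τ = ρ/(2d). In a batch of at
most N instances, p is hit more than K = 2 log d times with probability at most 8/d²
(`sum_batchWeight_hits_le`). Otherwise the likelihood ratio of the batch is within 1/2 of 1, because
ρK = 1/4. The truncated ratios minus one (`excess`) depend, given the locations, on disjoint blocks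
of fair signs, so by Hoeffding's lemma they are jointly subgaussian over all p
(`sum_exp_excess_le`).

The level-one inequality `sum_sq_condMean_le` is the heart of the argument: conditioning on a
message of probability c moves the N means by at most log(1/c)/2 in total square. A message of b
bits therefore carries divergence O(b) summed over all p, not for each p
(`sum_neg_log_obsRatio_le`). Divergences add along the chain, so M batches give O(Mb), and
Cauchy–Schwarz bounds the sum over p of the success probabilities by 1 + O(√(NMb))
(`sum_evolve_tilt_le`, `sum_evolve_message_le`). Here NM = O(m), and averaging over at least d²/4
pairs gives (b).

An online protocol with m ≥ d² is a chain over batches of d² instances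
(`OnlineProtocol.sum_success_le`). For m ≤ d², even the full sample does not reveal p
(`sum_batch_le`). -/

namespace SparsePCA

/-! ### Markov chains driven by independent finite inputs -/

section Chains

variable {S Y : Type*}

/-- The state after `n` steps of the update rule `F`, started at time `a` in the state `s`. -/
def run (F : ℕ → S → Y → S) (a : ℕ) (s : S) : (n : ℕ) → (Fin n → Y) → S
  | 0, _ => s
  | n + 1, X => F (a + n) (run F a s n (Fin.init X)) (X (Fin.last n))

theorem foldl_eq_run (F : ℕ → S → Y → S) (s : S) (n : ℕ) (x : Fin n → Y) :
    Fin.foldl n (fun w t => F t w (x t)) s = run F 0 s n x := by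
  induction n with
  | zero => simp [run]
  | succ n ih =>
    rw [Fin.foldl_succ_last]
    have := ih (Fin.init x)
    simp only [Fin.init] at this
    simp [run, this]

variable [Fintype Y]

/-- The expectation of `φ` after `n` steps of the update rule `F` from time `a`, as a function of
the initial state, when the inputs are independent with weights `w`. -/
noncomputable def evolve (F : ℕ → S → Y → S) (w : Y → ℝ) (a : ℕ) : ℕ → (S → ℝ) → S → ℝ
  | 0, φ => φ
  | n + 1, φ => evolve F w a n fun s => ∑ y, w y * φ (F (a + n) s y)

theorem sum_fin_succ_fun {n : ℕ} (f : (Fin (n + 1) → Y) → ℝ) :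
    ∑ X, f X = ∑ X : Fin n → Y, ∑ y, f (Fin.snoc (α := fun _ => Y) X y) := by
  rw [← (Fin.snocEquiv fun _ : Fin (n + 1) => Y).sum_comp, Fintype.sum_prod_type,
    Finset.sum_comm]
  rfl

/-- The recursion suits one-step inductions; this explicit form yields monotonicity and linearity in
`φ` and the link to product measures. -/
theorem evolve_eq_sum (F : ℕ → S → Y → S) (w : Y → ℝ) (a n : ℕ) (φ : S → ℝ) (s : S) :
    evolve F w a n φ s = ∑ X : Fin n → Y, (∏ t, w (X t)) * φ (run F a s n X) := by
  induction n generalizing φ with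
  | zero => simp [evolve, run]
  | succ n ih =>
    rw [evolve, ih, sum_fin_succ_fun]
    refine Finset.sum_congr rfl fun X _ => ?_
    rw [Finset.mul_sum]
    refine Finset.sum_congr rfl fun y _ => ?_
    simp only [run, Fin.init_snoc, Fin.snoc_last, Fin.prod_univ_castSucc, Fin.snoc_castSucc]
    ring

theorem evolve_add (F : ℕ → S → Y → S) (w : Y → ℝ) (a n k : ℕ) (φ : S → ℝ) :
    evolve F w a (n + k) φ = evolve F w a n (evolve F w (a + n) k φ) := by
  induction k generalizing φ with
  | zero => rfl
  | succ k ih =>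
    rw [← add_assoc, evolve, ih, evolve, add_assoc]

theorem evolve_mono (F : ℕ → S → Y → S) {w : Y → ℝ} (hw : ∀ y, 0 ≤ w y) (a n : ℕ)
    {φ ψ : S → ℝ} (h : ∀ s, φ s ≤ ψ s) (s : S) : evolve F w a n φ s ≤ evolve F w a n ψ s := by
  rw [evolve_eq_sum, evolve_eq_sum]
  exact Finset.sum_le_sum fun X _ =>
    mul_le_mul_of_nonneg_left (h _) (Finset.prod_nonneg fun t _ => hw _)

theorem sum_prod_eq_one {w : Y → ℝ} (hw : ∑ y, w y = 1) (n : ℕ) :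
    ∑ X : Fin n → Y, ∏ t, w (X t) = 1 := by
  rw [← Fintype.piFinset_univ, ← Finset.prod_univ_sum (fun _ => Finset.univ) fun _ y => w y]
  simp [hw]

theorem evolve_add_const (F : ℕ → S → Y → S) {w : Y → ℝ} (hw : ∑ y, w y = 1) (a n : ℕ)
    (φ : S → ℝ) (c : ℝ) (s : S) :
    evolve F w a n (fun s => φ s + c) s = evolve F w a n φ s + c := by
  simp only [evolve_eq_sum, mul_add, Finset.sum_add_distrib, ← Finset.sum_mul,
    sum_prod_eq_one hw, one_mul]

/-- Grouping the inputs of a chain into batches of length `n`. -/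
theorem evolve_batch (F : ℕ → S → Y → S) (w : Y → ℝ) (n M : ℕ) (φ : S → ℝ) :
    evolve (fun t s (X : Fin n → Y) => run F (t * n) s n X) (fun X => ∏ t, w (X t)) 0 M φ =
      evolve F w 0 (M * n) φ := by
  induction M generalizing φ with
  | zero => simp [evolve]
  | succ M ih =>
    rw [evolve, ih, Nat.succ_mul, evolve_add]
    congr 1
    funext s
    simp [evolve_eq_sum]

/-- Steps which leave the state unchanged do not change expectations. -/
theorem evolve_idle (F : ℕ → S → Y → S) {w : Y → ℝ} (hw : ∑ y, w y = 1) (n k : ℕ)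
    (hF : ∀ t, n ≤ t → ∀ s y, F t s y = s) (φ : S → ℝ) :
    evolve F w 0 (n + k) φ = evolve F w 0 n φ := by
  induction k generalizing φ with
  | zero => rfl
  | succ k ih =>
    rw [← add_assoc, evolve, ← ih φ]
    congr 1
    funext s
    have h : ∀ y, F (0 + (n + k)) s y = s := hF _ (by omega) s
    simp only [h, ← Finset.sum_mul, hw, one_mul]

/-- If the updates ignore the inputs, the law of the inputs is irrelevant. -/
theorem evolve_congr_weight (F : ℕ → S → Y → S) (hF : ∀ t s y y', F t s y = F t s y')
    {w w' : Y → ℝ} (hw : ∑ y, w y = 1) (hw' : ∑ y, w' y = 1) (a n : ℕ) (φ : S → ℝ) :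
    evolve F w a n φ = evolve F w' a n φ := by
  induction n generalizing φ with
  | zero => rfl
  | succ n ih =>
    rw [evolve, ih, evolve]
    congr 1
    funext s
    rcases isEmpty_or_nonempty Y with hY | ⟨⟨y₀⟩⟩
    · simp
    · simp only [hF _ s _ y₀, ← Finset.sum_mul, hw, hw']

/-- Swapping the input law in one step costs at most the mass `q`, because the test function stays
in [0, 1]; the costs add up over the steps. This pays for truncation: `h` will be the law restricted
to batches with too many hits. -/
theorem evolve_le_of_weight_le (F : ℕ → S → Y → S) {w w' h : Y → ℝ} {q : ℝ}
    (hw₀ : ∀ y, 0 ≤ w y) (hw : ∑ y, w y = 1) (hw₀' : ∀ y, 0 ≤ w' y) (hw' : ∑ y, w' y = 1)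
    (hh : ∀ y, 0 ≤ h y) (hq : ∑ y, h y ≤ q) (hle : ∀ y, w y ≤ w' y + h y) (a n : ℕ)
    {φ : S → ℝ} (hφ₀ : ∀ s, 0 ≤ φ s) (hφ₁ : ∀ s, φ s ≤ 1) (s : S) :
    evolve F w a n φ s ≤ evolve F w' a n φ s + n * q := by
  induction n generalizing φ with
  | zero => simp [evolve]
  | succ n ih =>
    have h1 : ∀ s, ∑ y, w y * φ (F (a + n) s y) ≤ ∑ y, w' y * φ (F (a + n) s y) + q := by
      intro s
      calc ∑ y, w y * φ (F (a + n) s y)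
          ≤ ∑ y, (w' y * φ (F (a + n) s y) + h y) := by
            refine Finset.sum_le_sum fun y _ => ?_
            have := mul_le_mul_of_nonneg_right (hle y) (hφ₀ (F (a + n) s y))
            have := mul_le_mul_of_nonneg_left (hφ₁ (F (a + n) s y)) (hh y)
            linarith
        _ ≤ _ := by rw [Finset.sum_add_distrib]; linarith
    have h2 := ih (φ := fun s => ∑ y, w y * φ (F (a + n) s y))
      (fun s => Finset.sum_nonneg fun y _ => mul_nonneg (hw₀ y) (hφ₀ _))
      (fun s => by
        rw [← hw]
        exact Finset.sum_le_sum fun y _ => mul_le_of_le_one_right (hw₀ y) (hφ₁ _))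
    have h3 := evolve_mono F hw₀' a n h1 s
    rw [evolve_add_const F hw'] at h3
    rw [evolve, evolve]
    push_cast
    linarith

end Chains

/-! ### Information carried by messages about a family of tilts -/

section Information

variable {S T Y ι : Type*} [Fintype Y]

/-- Level-one inequality: the conditional means, given an event, of a jointly subgaussian family
are controlled by the logarithm of the probability of the event. -/
theorem sum_sq_condMean_le [Fintype ι] {μ : Y → ℝ} (hμ : ∀ y, 0 < μ y) {g : ι → Y → ℝ}
    (hg : ∀ a : ι → ℝ, ∑ y, μ y * Real.exp (∑ p, a p * g p y) ≤ Real.exp ((∑ p, a p ^ 2) / 8))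
    (A : Finset Y) (hA : A.Nonempty) :
    ∑ p, ((∑ y ∈ A, μ y * g p y) / ∑ y ∈ A, μ y) ^ 2 ≤ -Real.log (∑ y ∈ A, μ y) / 2 := by
  set c := ∑ y ∈ A, μ y with hc
  have hc0 : 0 < c := Finset.sum_pos (fun y _ => hμ y) hA
  set a : ι → ℝ := fun p => (∑ y ∈ A, μ y * g p y) / c with ha
  set Q := ∑ p, a p ^ 2 with hQ
  -- The factor 4 is optimal: with λ in its place, Jensen gives (λ - λ²/8) Q ≤ -log c.
  have key := hg fun p => 4 * a p
  have e1 : (∑ p, (4 * a p) ^ 2) / 8 = 2 * Q := by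
    rw [hQ, Finset.sum_div, Finset.mul_sum]
    exact Finset.sum_congr rfl fun p _ => by ring
  rw [e1] at key
  have hJ : Real.exp (∑ y ∈ A, (μ y / c) * ∑ p, 4 * a p * g p y) ≤
      ∑ y ∈ A, (μ y / c) * Real.exp (∑ p, 4 * a p * g p y) := by
    have := convexOn_exp.map_sum_le (t := A) (w := fun y => μ y / c)
      (p := fun y => ∑ p, 4 * a p * g p y) (fun y _ => (div_pos (hμ y) hc0).le)
      (by rw [← Finset.sum_div]; exact div_self hc0.ne') (fun y _ => Set.mem_univ _)
    simpa [smul_eq_mul] using this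
  have e2 : ∑ y ∈ A, (μ y / c) * ∑ p, 4 * a p * g p y = 4 * Q := by
    simp only [Finset.mul_sum, hQ]
    rw [Finset.sum_comm]
    refine Finset.sum_congr rfl fun p _ => ?_
    have : a p ^ 2 = a p * ((∑ y ∈ A, μ y * g p y) / c) := by rw [sq]
    rw [this, Finset.sum_div, Finset.mul_sum, Finset.mul_sum]
    exact Finset.sum_congr rfl fun y _ => by ring
  have e3 : ∑ y ∈ A, (μ y / c) * Real.exp (∑ p, 4 * a p * g p y) ≤ Real.exp (2 * Q) / c := by
    have : ∑ y ∈ A, μ y * Real.exp (∑ p, 4 * a p * g p y) ≤ Real.exp (2 * Q) :=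
      (Finset.sum_le_sum_of_subset_of_nonneg (Finset.subset_univ A)
        fun y _ _ => mul_nonneg (hμ y).le (Real.exp_pos _).le).trans key
    calc _ = (∑ y ∈ A, μ y * Real.exp (∑ p, 4 * a p * g p y)) / c := by
          rw [Finset.sum_div]; exact Finset.sum_congr rfl fun y _ => by ring
      _ ≤ _ := by gcongr
  rw [e2] at hJ
  have h4 := hJ.trans e3
  rw [le_div_iff₀ hc0] at h4
  have h5 := Real.log_le_log (by positivity) h4
  rw [Real.log_mul (Real.exp_pos _).ne' hc0.ne', Real.log_exp, Real.log_exp] at h5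
  linarith

open Classical in
/-- The fibre of `G` through `y`. -/
noncomputable def fibre (G : Y → T) (y : Y) : Finset Y := Finset.univ.filter fun y' => G y' = G y

theorem self_mem_fibre (G : Y → T) (y : Y) : y ∈ fibre G y := by simp [fibre]

theorem fibre_congr {G : Y → T} {y y' : Y} (h : G y' = G y) : fibre G y' = fibre G y := by
  unfold fibre; rw [h]

/-- The likelihood ratio of the observation `G y`, when the input law `μ` is tilted
by `1 + g`. -/
noncomputable def obsRatio (μ g : Y → ℝ) (G : Y → T) (y : Y) : ℝ :=
  1 + (∑ y' ∈ fibre G y, μ y' * g y') / ∑ y' ∈ fibre G y, μ y'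

theorem sum_fibre_pos {μ : Y → ℝ} (hμ : ∀ y, 0 < μ y) (G : Y → T) (y : Y) :
    0 < ∑ y' ∈ fibre G y, μ y' :=
  Finset.sum_pos (fun y _ => hμ y) ⟨y, self_mem_fibre G y⟩

theorem half_le_obsRatio {μ g : Y → ℝ} (hμ : ∀ y, 0 < μ y) (hg : ∀ y, -(1 / 2) ≤ g y)
    (G : Y → T) (y : Y) : 1 / 2 ≤ obsRatio μ g G y := by
  have hc := sum_fibre_pos hμ G y
  have : -(1 / 2) ≤ (∑ y' ∈ fibre G y, μ y' * g y') / ∑ y' ∈ fibre G y, μ y' := by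
    rw [le_div_iff₀ hc, Finset.mul_sum]
    exact Finset.sum_le_sum fun y' _ => by nlinarith [hμ y', hg y']
  unfold obsRatio
  linarith

/-- Averaging over a fibre does not change expectations of functions of the observation. -/
theorem sum_fibre_average {μ : Y → ℝ} (hμ : ∀ y, 0 < μ y) (h : Y → ℝ) (G : Y → T) (ψ : T → ℝ) :
    ∑ y, μ y * ((∑ y' ∈ fibre G y, h y') / ∑ y' ∈ fibre G y, μ y') * ψ (G y) =
      ∑ y, h y * ψ (G y) := by
  classical
  have e : ∀ y, μ y * ((∑ y' ∈ fibre G y, h y') / ∑ y' ∈ fibre G y, μ y') * ψ (G y) =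
      ∑ y', if G y' = G y then μ y / (∑ z ∈ fibre G y', μ z) * (h y' * ψ (G y')) else 0 := by
    intro y
    rw [← Finset.sum_filter, Finset.sum_div, Finset.mul_sum, Finset.sum_mul]
    have : fibre G y = Finset.univ.filter fun y' => G y' = G y := by
      ext; simp [fibre]
    rw [← this]
    refine Finset.sum_congr rfl fun y' hy' => ?_
    have hG : G y' = G y := by simpa [fibre] using hy'
    rw [fibre_congr hG, hG]
    ring
  simp_rw [e]
  rw [Finset.sum_comm]
  refine Finset.sum_congr rfl fun y' _ => ?_
  have : ∀ y, (if G y' = G y then μ y / (∑ z ∈ fibre G y', μ z) * (h y' * ψ (G y')) else 0) =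
      if G y = G y' then μ y / (∑ z ∈ fibre G y', μ z) * (h y' * ψ (G y')) else 0 := by
    intro y; simp only [eq_comm]
  simp_rw [this]
  rw [← Finset.sum_filter, ← Finset.sum_mul, ← Finset.sum_div]
  have hf : fibre G y' = Finset.univ.filter fun y => G y = G y' := by
    ext; simp [fibre]
  rw [← hf, div_self (sum_fibre_pos hμ G y').ne', one_mul]

/-- A function of the observation alone sees only the average of the tilt over each fibre. -/
theorem sum_mul_obsRatio {μ g : Y → ℝ} (hμ : ∀ y, 0 < μ y) (G : Y → T) (ψ : T → ℝ) :
    ∑ y, μ y * obsRatio μ g G y * ψ (G y) = ∑ y, μ y * (1 + g y) * ψ (G y) := by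
  have := sum_fibre_average hμ (fun y => μ y * g y) G ψ
  simp only [obsRatio, mul_add, add_mul, mul_one, Finset.sum_add_distrib, this]

/-- The entropy of an observation with at most `B` values is at most `log B`. -/
theorem sum_neg_log_fibre_le {μ : Y → ℝ} (hμ : ∀ y, 0 < μ y) (hμ1 : ∑ y, μ y = 1) (G : Y → T)
    {B : ℕ} (hB : (Set.range G).ncard ≤ B) :
    ∑ y, μ y * -Real.log (∑ y' ∈ fibre G y, μ y') ≤ Real.log B := by
  classical
  have hne : Nonempty Y := by
    by_contra h
    rw [not_nonempty_iff] at h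
    simp at hμ1
  have hfin : (Set.range G).Finite := Set.finite_range G
  have hB0 : 0 < B := lt_of_lt_of_le
    ((Set.ncard_pos hfin).2 (Set.range_nonempty G)) hB
  have hB' : (0 : ℝ) < B := by exact_mod_cast hB0
  -- Each fibre contributes exactly 1, so the mean of the reciprocal fibre mass counts the values of
  -- `G`.
  have hcount : ∑ y, μ y * (1 / ∑ y' ∈ fibre G y, μ y') = ((Set.range G).ncard : ℝ) := by
    have himg : (Set.range G).ncard = (Finset.univ.image G).card := by
      rw [← Set.ncard_coe_finset]; simp
    rw [himg, Finset.card_eq_sum_ones, Nat.cast_sum,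
      ← Finset.sum_fiberwise_of_maps_to (s := Finset.univ) (t := Finset.univ.image G) (g := G)
        (fun y _ => Finset.mem_image_of_mem _ (Finset.mem_univ y))]
    refine Finset.sum_congr rfl fun v hv => ?_
    obtain ⟨y₀, -, rfl⟩ := Finset.mem_image.1 hv
    have hf : fibre G y₀ = Finset.univ.filter fun y => G y = G y₀ := by ext; simp [fibre]
    rw [← hf]
    have : ∀ y ∈ fibre G y₀, μ y * (1 / ∑ y' ∈ fibre G y, μ y') =
        μ y / ∑ y' ∈ fibre G y₀, μ y' := by
      intro y hy
      have hG : G y = G y₀ := by simpa [fibre] using hy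
      rw [fibre_congr hG]; ring
    rw [Finset.sum_congr rfl this, ← Finset.sum_div, div_self (sum_fibre_pos hμ G y₀).ne']
    simp
  -- This is log x ≤ x - 1 at x = 1/(B · mass of the fibre).
  have hpt : ∀ y, μ y * -Real.log (∑ y' ∈ fibre G y, μ y') ≤
      μ y * (1 / ∑ y' ∈ fibre G y, μ y') / B + μ y * (Real.log B - 1) := by
    intro y
    have hc := sum_fibre_pos hμ G y
    have h := Real.log_le_sub_one_of_pos (x := 1 / (∑ y' ∈ fibre G y, μ y') / B) (by positivity)
    rw [Real.log_div (by positivity) hB'.ne', one_div, Real.log_inv] at h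
    have := mul_le_mul_of_nonneg_left h (hμ y).le
    rw [one_div]
    have e : μ y * (∑ y' ∈ fibre G y, μ y')⁻¹ / B = μ y * ((∑ y' ∈ fibre G y, μ y')⁻¹ / B) := by
      ring
    rw [e]
    linarith
  refine (Finset.sum_le_sum fun y _ => hpt y).trans ?_
  rw [Finset.sum_add_distrib, ← Finset.sum_div, hcount, ← Finset.sum_mul, hμ1]
  have : ((Set.range G).ncard : ℝ) / B ≤ 1 := by
    rw [div_le_one hB']; exact_mod_cast hB
  linarith

/-- The linear term is kept apart because it averages to zero under the base law; what remains is
quadratic, with the factor 2 coming from r ≥ 1/2. -/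
theorem neg_log_le_of_half_le {r : ℝ} (hr : 1 / 2 ≤ r) :
    -Real.log r ≤ (1 - r) + 2 * (r - 1) ^ 2 := by
  have h0 : 0 < r := by linarith
  have h := Real.log_le_sub_one_of_pos (x := r⁻¹) (by positivity)
  rw [Real.log_inv] at h
  have : r⁻¹ - 1 ≤ (1 - r) + 2 * (r - 1) ^ 2 := by
    have e : r⁻¹ - 1 = (1 - r) + (r - 1) ^ 2 / r := by field_simp; ring
    rw [e]
    have : (r - 1) ^ 2 / r ≤ 2 * (r - 1) ^ 2 := by
      rw [div_le_iff₀ h0]; nlinarith [sq_nonneg (r - 1)]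
    linarith
  linarith

/-- The information that one observation with at most `B` values carries about the family
of tilts. -/
theorem sum_neg_log_obsRatio_le [Fintype ι] {μ : Y → ℝ} (hμ : ∀ y, 0 < μ y) (hμ1 : ∑ y, μ y = 1)
    {g : ι → Y → ℝ} (hg₀ : ∀ p y, -(1 / 2) ≤ g p y) (hg₁ : ∀ p, ∑ y, μ y * g p y = 0)
    (hg : ∀ a : ι → ℝ, ∑ y, μ y * Real.exp (∑ p, a p * g p y) ≤ Real.exp ((∑ p, a p ^ 2) / 8))
    (G : Y → T) {B : ℕ} (hB : (Set.range G).ncard ≤ B) :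
    ∑ y, μ y * ∑ p, -Real.log (obsRatio μ (g p) G y) ≤ Real.log B := by
  -- The factor 2 of the quadratic term cancels the 1/2 in the level-one inequality.
  have h1 : ∀ y, ∑ p, -Real.log (obsRatio μ (g p) G y) ≤
      ∑ p, (1 - obsRatio μ (g p) G y) + -Real.log (∑ y' ∈ fibre G y, μ y') := by
    intro y
    have hl := sum_sq_condMean_le hμ hg (fibre G y) ⟨y, self_mem_fibre G y⟩
    have : ∑ p, -Real.log (obsRatio μ (g p) G y) ≤
        ∑ p, ((1 - obsRatio μ (g p) G y) + 2 * (obsRatio μ (g p) G y - 1) ^ 2) :=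
      Finset.sum_le_sum fun p _ => neg_log_le_of_half_le (half_le_obsRatio hμ (hg₀ p) G y)
    rw [Finset.sum_add_distrib, ← Finset.mul_sum] at this
    have e : ∀ p, obsRatio μ (g p) G y - 1 =
        (∑ y' ∈ fibre G y, μ y' * g p y') / ∑ y' ∈ fibre G y, μ y' := fun p => by
      simp [obsRatio]
    simp only [e] at this
    linarith
  have h2 : ∀ p, ∑ y, μ y * (1 - obsRatio μ (g p) G y) = 0 := by
    intro p
    have := sum_mul_obsRatio (g := g p) hμ G fun _ => 1
    simp only [mul_one, mul_add, Finset.sum_add_distrib, hg₁] at this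
    simp only [mul_sub, mul_one, Finset.sum_sub_distrib, this]
    ring
  calc _ ≤ ∑ y, μ y * (∑ p, (1 - obsRatio μ (g p) G y) + -Real.log (∑ y' ∈ fibre G y, μ y')) :=
        Finset.sum_le_sum fun y _ => mul_le_mul_of_nonneg_left (h1 y) (hμ y).le
    _ = ∑ p, ∑ y, μ y * (1 - obsRatio μ (g p) G y) +
        ∑ y, μ y * -Real.log (∑ y' ∈ fibre G y, μ y') := by
        simp only [mul_add, Finset.sum_add_distrib, Finset.mul_sum]
        rw [Finset.sum_comm]
    _ ≤ Real.log B := by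
        simp only [h2, Finset.sum_const_zero, zero_add]
        exact sum_neg_log_fibre_le hμ hμ1 G hB

/-- The update rule which also records the logarithmic likelihood ratios of the states. -/
noncomputable def withLogRatio (F : ℕ → S → Y → S) (μ : Y → ℝ) (g : ι → Y → ℝ) :
    ℕ → S × (ι → ℝ) → Y → S × (ι → ℝ) :=
  fun t z y => (F t z.1 y, fun p => z.2 p + Real.log (obsRatio μ (g p) (F t z.1) y))

/-- Change of measure. Since the test function sees only the state, each step contributes the
likelihood ratio of the new state given the old one, not that of the input. -/
theorem evolve_tilt (F : ℕ → S → Y → S) {μ : Y → ℝ} (hμ : ∀ y, 0 < μ y) {g : ι → Y → ℝ}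
    (hg₀ : ∀ p y, -(1 / 2) ≤ g p y) (p : ι) (M : ℕ) (φ : S → ℝ) (s : S) :
    evolve F (fun y => μ y * (1 + g p y)) 0 M φ s =
      evolve (withLogRatio F μ g) μ 0 M (fun z => Real.exp (z.2 p) * φ z.1) (s, 0) := by
  induction M generalizing φ with
  | zero => simp [evolve]
  | succ M ih =>
    rw [evolve, ih, evolve]
    congr 1
    funext z
    rw [← sum_mul_obsRatio hμ, Finset.mul_sum]
    refine Finset.sum_congr rfl fun y _ => ?_
    have := half_le_obsRatio hμ (hg₀ p) (F (0 + M) z.1) y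
    simp only [withLogRatio]
    rw [Real.exp_add, Real.exp_log (by linarith)]
    ring

/-- Chain rule for relative entropy: the one-step bound is uniform in the current state, so it adds
up. -/
theorem evolve_neg_logRatio_le [Fintype ι] (F : ℕ → S → Y → S) {μ : Y → ℝ} (hμ : ∀ y, 0 < μ y)
    (hμ1 : ∑ y, μ y = 1) {g : ι → Y → ℝ} {V : ℝ}
    (hV : ∀ t s, ∑ y, μ y * ∑ p, -Real.log (obsRatio μ (g p) (F t s) y) ≤ V) (M : ℕ) (s : S) :
    evolve (withLogRatio F μ g) μ 0 M (fun z => ∑ p, -z.2 p) (s, 0) ≤ M * V := by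
  induction M with
  | zero => simp [evolve]
  | succ M ih =>
    rw [evolve]
    have h1 : ∀ z : S × (ι → ℝ), ∑ y, μ y * ∑ p, -(withLogRatio F μ g (0 + M) z y).2 p ≤
        ∑ p, -z.2 p + V := by
      intro z
      have := hV (0 + M) z.1
      simp only [withLogRatio, neg_add, Finset.sum_add_distrib, mul_add]
      rw [← Finset.sum_mul, hμ1, one_mul]
      linarith
    have h2 := evolve_mono (withLogRatio F μ g) (fun y => (hμ y).le) 0 M h1 (s, 0)
    rw [evolve_add_const _ hμ1] at h2
    push_cast
    linarith

/-- With r = exp(ℓ/2), write |r² - 1| = |r - 1|(r + 1) and apply Cauchy–Schwarz to all pairs (p, x)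
at once. The squares of r - 1 form a Hellinger distance, bounded by the divergence; those of r + 1
have mean at most 4 for each p. -/
theorem sum_abs_exp_sub_one_le [Fintype ι] {X : Type*} [Fintype X] {W : X → ℝ} (hW : ∀ x, 0 ≤ W x)
    (hW1 : ∑ x, W x = 1) {ℓ : ι → X → ℝ} (hℓ : ∀ p, ∑ x, W x * Real.exp (ℓ p x) = 1) :
    ∑ p, ∑ x, W x * |Real.exp (ℓ p x) - 1| ≤
      Real.sqrt (4 * Fintype.card ι * ∑ x, W x * ∑ p, -ℓ p x) := by
  set r : ι → X → ℝ := fun p x => Real.exp (ℓ p x / 2) with hr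
  have hrr : ∀ p x, Real.exp (ℓ p x) = r p x ^ 2 := by
    intro p x
    simp only [hr]; rw [← Real.exp_nat_mul]; congr 1; push_cast; ring
  have hr0 : ∀ p x, 0 < r p x := fun p x => Real.exp_pos _
  have hA : ∀ p, ∑ x, W x * (r p x - 1) ^ 2 ≤ ∑ x, W x * -ℓ p x := by
    intro p
    have h1 : ∀ x, 2 - 2 * r p x ≤ -ℓ p x := by
      intro x
      have := Real.add_one_le_exp (ℓ p x / 2)
      simp only [hr]; linarith
    calc ∑ x, W x * (r p x - 1) ^ 2
        = ∑ x, (W x * Real.exp (ℓ p x) - W x + W x * (2 - 2 * r p x)) :=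
          Finset.sum_congr rfl fun x _ => by rw [hrr]; ring
      _ = ∑ x, W x * (2 - 2 * r p x) := by
          rw [Finset.sum_add_distrib, Finset.sum_sub_distrib, hℓ, hW1]; ring
      _ ≤ _ := Finset.sum_le_sum fun x _ => mul_le_mul_of_nonneg_left (h1 x) (hW x)
  have hB : ∀ p, ∑ x, W x * (r p x + 1) ^ 2 ≤ 4 := by
    intro p
    calc ∑ x, W x * (r p x + 1) ^ 2 ≤ ∑ x, (2 * (W x * Real.exp (ℓ p x)) + 2 * W x) :=
          Finset.sum_le_sum fun x _ => by
            rw [hrr]; nlinarith [mul_nonneg (hW x) (sq_nonneg (r p x - 1))]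
      _ = 4 := by rw [Finset.sum_add_distrib, ← Finset.mul_sum, ← Finset.mul_sum, hℓ, hW1]; norm_num
  have hsplit : ∀ p x, W x * |Real.exp (ℓ p x) - 1| =
      (Real.sqrt (W x) * |r p x - 1|) * (Real.sqrt (W x) * (r p x + 1)) := by
    intro p x
    have : |Real.exp (ℓ p x) - 1| = |r p x - 1| * (r p x + 1) := by
      rw [hrr, show r p x ^ 2 - 1 = (r p x - 1) * (r p x + 1) by ring, abs_mul,
        abs_of_pos (show 0 < r p x + 1 by linarith [hr0 p x])]
    rw [this]
    nth_rewrite 1 [← Real.mul_self_sqrt (hW x)]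
    ring
  have hcs := Finset.sum_mul_sq_le_sq_mul_sq (Finset.univ : Finset (ι × X))
    (fun z => Real.sqrt (W z.2) * |r z.1 z.2 - 1|) (fun z => Real.sqrt (W z.2) * (r z.1 z.2 + 1))
  simp only [Fintype.sum_prod_type, mul_pow, sq_abs, Real.sq_sqrt (hW _), ← hsplit] at hcs
  apply Real.le_sqrt_of_sq_le
  refine hcs.trans ?_
  have h1 : ∑ p, ∑ x, W x * (r p x - 1) ^ 2 ≤ ∑ x, W x * ∑ p, -ℓ p x := by
    simp only [Finset.mul_sum]
    rw [Finset.sum_comm (s := (Finset.univ : Finset X))]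
    exact Finset.sum_le_sum fun p _ => hA p
  have h2 : ∑ p, ∑ x, W x * (r p x + 1) ^ 2 ≤ (4 * Fintype.card ι : ℝ) := by
    refine (Finset.sum_le_sum fun p _ => hB p).trans ?_
    simp [mul_comm]
  have h3 : 0 ≤ ∑ p, ∑ x, W x * (r p x - 1) ^ 2 :=
    Finset.sum_nonneg fun p _ => Finset.sum_nonneg fun x _ => mul_nonneg (hW x) (sq_nonneg _)
  have h4 : (0 : ℝ) ≤ 4 * Fintype.card ι := by positivity
  calc _ ≤ (∑ x, W x * ∑ p, -ℓ p x) * (4 * Fintype.card ι) :=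
        mul_le_mul h1 h2 (Finset.sum_nonneg fun p _ => Finset.sum_nonneg fun x _ =>
          mul_nonneg (hW x) (sq_nonneg _)) (h3.trans h1)
    _ = _ := by ring

open Classical in
/-- A chain whose steps have at most `B` outcomes cannot identify the tilt of its inputs. -/
theorem sum_evolve_tilt_le [Fintype ι] (F : ℕ → S → Y → S) {μ : Y → ℝ} (hμ : ∀ y, 0 < μ y)
    (hμ1 : ∑ y, μ y = 1) {g : ι → Y → ℝ} (hg₀ : ∀ p y, -(1 / 2) ≤ g p y)
    (hg₁ : ∀ p, ∑ y, μ y * g p y = 0)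
    (hg : ∀ a : ι → ℝ, ∑ y, μ y * Real.exp (∑ p, a p * g p y) ≤ Real.exp ((∑ p, a p ^ 2) / 8))
    {B : ℕ} (hB : ∀ t s, (Set.range (F t s)).ncard ≤ B) (out : S → ι) (M : ℕ) (s : S) :
    ∑ p, evolve F (fun y => μ y * (1 + g p y)) 0 M (fun s => if out s = p then 1 else 0) s ≤
      1 + Real.sqrt (4 * Fintype.card ι * (M * Real.log B)) := by
  set W : (Fin M → Y) → ℝ := fun X => ∏ t, μ (X t) with hWdef
  have hW : ∀ X, 0 ≤ W X := fun X => Finset.prod_nonneg fun t _ => (hμ _).le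
  have hW1 : ∑ X, W X = 1 := sum_prod_eq_one hμ1 M
  set Z : (Fin M → Y) → S × (ι → ℝ) := fun X => run (withLogRatio F μ g) 0 (s, 0) M X with hZ
  have htilt : ∀ p φ, evolve F (fun y => μ y * (1 + g p y)) 0 M φ s =
      ∑ X, W X * (Real.exp ((Z X).2 p) * φ (Z X).1) := by
    intro p φ
    rw [evolve_tilt F hμ hg₀, evolve_eq_sum]
  have hℓ : ∀ p, ∑ X, W X * Real.exp ((Z X).2 p) = 1 := by
    intro p
    have := htilt p fun _ => 1
    simp only [mul_one] at this
    rw [← this, evolve_eq_sum]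
    simp only [mul_one]
    refine sum_prod_eq_one (w := fun y => μ y * (1 + g p y)) ?_ M
    simp only [mul_add, mul_one, Finset.sum_add_distrib, hμ1, hg₁, add_zero]
  have hinfo : ∑ X, W X * ∑ p, -(Z X).2 p ≤ M * Real.log B := by
    have := evolve_neg_logRatio_le F hμ hμ1
      (fun t s => sum_neg_log_obsRatio_le hμ hμ1 hg₀ hg₁ hg (F t s) (hB t s)) M s
    rwa [evolve_eq_sum] at this
  have hcs := sum_abs_exp_sub_one_le hW hW1 (ℓ := fun p X => (Z X).2 p) hℓ
  -- Under the untilted law the output equals exactly one p; this is the 1 in the bound.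
  have hone : ∑ p, ∑ X, W X * (if out (Z X).1 = p then 1 else 0) = 1 := by
    rw [Finset.sum_comm]
    simp only [← Finset.mul_sum, Finset.sum_ite_eq, Finset.mem_univ, if_true, mul_one, hW1]
  have hpt : ∀ p, ∑ X, W X * (Real.exp ((Z X).2 p) * if out (Z X).1 = p then 1 else 0) ≤
      ∑ X, W X * (if out (Z X).1 = p then 1 else 0) + ∑ X, W X * |Real.exp ((Z X).2 p) - 1| := by
    intro p
    rw [← Finset.sum_add_distrib]
    refine Finset.sum_le_sum fun X _ => ?_
    rw [← mul_add]
    refine mul_le_mul_of_nonneg_left ?_ (hW X)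
    have := le_abs_self (Real.exp ((Z X).2 p) - 1)
    have := abs_nonneg (Real.exp ((Z X).2 p) - 1)
    split_ifs <;> linarith
  simp only [htilt]
  refine (Finset.sum_le_sum fun p _ => hpt p).trans ?_
  rw [Finset.sum_add_distrib, hone]
  have : Real.sqrt (4 * Fintype.card ι * ∑ X, W X * ∑ p, -(Z X).2 p) ≤
      Real.sqrt (4 * Fintype.card ι * (M * Real.log B)) := by
    apply Real.sqrt_le_sqrt
    gcongr
  linarith

end Information

/-! ### Batches of located signs and their truncated likelihood ratios -/

section Batches

variable {α D : Type*}

/-- The sign encoded by a bit. -/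
def sgn (s : Bool) : ℝ := if s then 1 else -1

theorem sum_sgn (c : ℝ) : ∑ s, c * sgn s = 0 := by simp [sgn]

theorem sum_one_add_sgn (c : ℝ) : ∑ s, (1 + c * sgn s) = 2 := by
  rw [Finset.sum_add_distrib, sum_sgn]; simp

theorem abs_sgn (s : Bool) : |sgn s| = 1 := by cases s <;> simp [sgn]

theorem sum_prod_fun [Fintype α] [DecidableEq α] [Fintype D] (w : α → D → ℝ) :
    ∑ X : α → D, ∏ t, w t (X t) = ∏ t, ∑ e, w t e := by
  rw [Finset.prod_univ_sum, Fintype.piFinset_univ]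

/-- Hoeffding's lemma for the uniform distribution on a finite type. -/
theorem sum_exp_le_of_abs_le [Fintype α] {G : α → ℝ} (hG : ∀ u, |G u| ≤ 1 / 2)
    (h0 : ∑ u, G u = 0) (a : ℝ) :
    ∑ u, Real.exp (a * G u) ≤ Fintype.card α * Real.exp (a ^ 2 / 8) := by
  have hpt : ∀ u, Real.exp (a * G u) ≤
      (1 / 2 + G u) * Real.exp (a / 2) + (1 / 2 - G u) * Real.exp (-(a / 2)) := by
    intro u
    have h := abs_le.1 (hG u)
    have := convexOn_exp.2 (Set.mem_univ (a / 2)) (Set.mem_univ (-(a / 2)))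
      (show 0 ≤ 1 / 2 + G u by linarith) (show 0 ≤ 1 / 2 - G u by linarith) (by ring)
    simp only [smul_eq_mul] at this
    refine le_trans (le_of_eq ?_) this
    congr 1; ring
  have hc := Real.cosh_le_exp_half_sq (a / 2)
  rw [Real.cosh_eq] at hc
  calc ∑ u, Real.exp (a * G u) ≤ _ := Finset.sum_le_sum fun u _ => hpt u
    _ = Fintype.card α * ((Real.exp (a / 2) + Real.exp (-(a / 2))) / 2) := by
        simp only [add_mul, sub_mul, Finset.sum_add_distrib, Finset.sum_sub_distrib,
          ← Finset.sum_mul, h0, Finset.sum_const, Finset.card_univ, nsmul_eq_mul]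
        ring
    _ ≤ _ := by
        refine mul_le_mul_of_nonneg_left (hc.trans (le_of_eq ?_)) (Nat.cast_nonneg _)
        congr 1; ring

/-- Functions on a type correspond to families of functions on the fibres of a map. -/
def fibreFunEquiv (Z : α → D) (β : Type*) : (α → β) ≃ (∀ p, {t // Z t = p} → β) where
  toFun s _ t := s t
  invFun u t := u (Z t) ⟨t, rfl⟩
  left_inv _ := rfl
  right_inv u := by
    funext p ⟨t, ht⟩
    subst ht
    rfl

/-- Independence of the sign blocks at different locations, once the locations `Z` are fixed. -/
theorem sum_prod_fibres [Fintype α] [DecidableEq α] [Fintype D] [DecidableEq D] (Z : α → D)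
    (h : ∀ p, ({t // Z t = p} → Bool) → ℝ) :
    ∑ s : α → Bool, ∏ p, h p (fun t => s t) = ∏ p, ∑ u, h p u := by
  rw [Finset.prod_univ_sum, Fintype.piFinset_univ, ← (fibreFunEquiv Z Bool).sum_comp]
  rfl

theorem sum_batches [Fintype α] [DecidableEq α] [Fintype D] (f : (α → D × Bool) → ℝ) :
    ∑ y, f y = ∑ Z : α → D, ∑ s : α → Bool, f fun t => (Z t, s t) := by
  rw [← Fintype.sum_prod_type', ← (Equiv.arrowProdEquivProdArrow α (fun _ => D)
    (fun _ => Bool)).symm.sum_comp]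
  rfl

theorem sum_baseWeight [Fintype α] [DecidableEq α] [Fintype D]
    [Nonempty D] :
    ∑ _y : α → D × Bool, (1 / (2 * Fintype.card D : ℝ)) ^ Fintype.card α = 1 := by
  have hN : (0 : ℝ) < Fintype.card D := by exact_mod_cast Fintype.card_pos
  rw [Finset.sum_const, Finset.card_univ, Fintype.card_fun, Fintype.card_prod, Fintype.card_bool,
    nsmul_eq_mul, one_div, inv_pow]
  push_cast
  rw [mul_comm (2 : ℝ)]
  exact mul_inv_cancel₀ (by positivity)

variable [Fintype α] [DecidableEq D]

/-- The likelihood ratio of a batch when the sign at the location `p` has bias `ρ`. -/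
noncomputable def lik (ρ : ℝ) (p : D) (y : α → D × Bool) : ℝ :=
  ∏ t, (1 + (if (y t).1 = p then ρ else 0) * sgn (y t).2)

/-- The number of instances of a batch at the location `p`. -/
def hits (p : D) (y : α → D × Bool) : ℕ := Fintype.card {t // (y t).1 = p}

/-- The likelihood ratio minus one, truncated when there are more than `K` hits. -/
noncomputable def excess (ρ K : ℝ) (p : D) (y : α → D × Bool) : ℝ :=
  if (hits p y : ℝ) ≤ K then lik ρ p y - 1 else 0

theorem lik_eq_prod_fibre (ρ : ℝ) (p : D) (y : α → D × Bool) :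
    lik ρ p y = ∏ t : {t // (y t).1 = p}, (1 + ρ * sgn (y t).2) := by
  rw [lik, ← Finset.prod_subtype (Finset.univ.filter fun t => (y t).1 = p) (by simp)
    (fun t => 1 + ρ * sgn (y t).2), Finset.prod_filter]
  refine Finset.prod_congr rfl fun t _ => ?_
  split_ifs <;> simp

/-- With k ≤ K factors, the product lies between (1 - ρ)^k ≥ 1 - kρ ≥ 3/4 and (1 + ρ)^k ≤ e^{1/4} ≤
4/3. -/
theorem abs_prod_sub_one_le {ρ K : ℝ} (hρ₀ : 0 ≤ ρ) (hρ₁ : ρ ≤ 1) (hK : ρ * K ≤ 1 / 4)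
    (hα : (Fintype.card α : ℝ) ≤ K) (s : α → Bool) :
    |∏ t, (1 + ρ * sgn (s t)) - 1| ≤ 1 / 2 := by
  have hb : ∀ t, 1 - ρ ≤ 1 + ρ * sgn (s t) ∧ 1 + ρ * sgn (s t) ≤ 1 + ρ := by
    intro t; cases s t <;> simp only [sgn, if_true, Bool.false_eq_true, if_false] <;> constructor <;> linarith
  have hk : (Fintype.card α : ℝ) * ρ ≤ 1 / 4 := by nlinarith
  have hup : ∏ t, (1 + ρ * sgn (s t)) ≤ 3 / 2 := by
    calc _ ≤ ∏ _t : α, Real.exp ρ := Finset.prod_le_prod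
          (fun t _ => by linarith [(hb t).1])
          (fun t _ => (hb t).2.trans (by linarith [Real.add_one_le_exp ρ]))
      _ = Real.exp (Fintype.card α * ρ) := by simp [Real.exp_nat_mul]
      _ ≤ Real.exp (1 / 4) := Real.exp_le_exp.2 hk
      _ ≤ 1 / (1 - 1 / 4) := Real.exp_bound_div_one_sub_of_interval (by norm_num) (by norm_num)
      _ ≤ 3 / 2 := by norm_num
  have hlo : 3 / 4 ≤ ∏ t, (1 + ρ * sgn (s t)) := by
    calc (3 / 4 : ℝ) ≤ 1 + Fintype.card α * (-ρ) := by linarith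
      _ ≤ (1 + -ρ) ^ Fintype.card α := one_add_mul_le_pow (by linarith) _
      _ = ∏ _t : α, (1 - ρ) := by simp [sub_eq_add_neg]
      _ ≤ _ := Finset.prod_le_prod (fun t _ => by linarith) (fun t _ => (hb t).1)
  rw [abs_le]; constructor <;> linarith

theorem sum_prod_one_add_sgn [DecidableEq α] (c : α → ℝ) :
    ∑ s : α → Bool, ∏ t, (1 + c t * sgn (s t)) = 2 ^ Fintype.card α := by
  rw [sum_prod_fun fun t s => 1 + c t * sgn s]
  simp only [sum_one_add_sgn, Finset.prod_const, Finset.card_univ]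

theorem abs_excess_le {ρ K : ℝ} (hρ₀ : 0 ≤ ρ) (hρ₁ : ρ ≤ 1) (hK : ρ * K ≤ 1 / 4) (p : D)
    (y : α → D × Bool) : |excess ρ K p y| ≤ 1 / 2 := by
  unfold excess
  split_ifs with h
  · rw [lik_eq_prod_fibre]
    exact abs_prod_sub_one_le hρ₀ hρ₁ hK h fun t => (y t).2
  · norm_num

variable [Fintype D]

/-- The law of one instance: the location is uniform, and the sign has bias `ρ` if the location
is `p`. -/
noncomputable def instWeight (ρ : ℝ) (p : D) (e : D × Bool) : ℝ :=
  (1 + (if e.1 = p then ρ else 0) * sgn e.2) / (2 * Fintype.card D)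

/-- The law of a batch of independent instances. -/
noncomputable def batchWeight (ρ : ℝ) (p : D) (y : α → D × Bool) : ℝ := ∏ t, instWeight ρ p (y t)

theorem instWeight_nonneg {ρ : ℝ} (hρ₀ : 0 ≤ ρ) (hρ₁ : ρ ≤ 1) (p : D) (e : D × Bool) :
    0 ≤ instWeight ρ p e := by
  unfold instWeight
  refine div_nonneg ?_ (by positivity)
  cases e.2 <;> split_ifs <;> simp [sgn] <;> linarith

theorem sum_instWeight_mul (ρ : ℝ) (p : D) (f : D → ℝ) :
    ∑ e, instWeight ρ p e * f e.1 = (∑ z, f z) / Fintype.card D := by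
  rw [Fintype.sum_prod_type, Finset.sum_div]
  refine Finset.sum_congr rfl fun z _ => ?_
  have := sum_one_add_sgn (if z = p then ρ else 0)
  simp only [instWeight]
  rw [← Finset.sum_mul, ← Finset.sum_div, this]
  field_simp

theorem sum_instWeight [Nonempty D] (ρ : ℝ) (p : D) : ∑ e, instWeight ρ p e = 1 := by
  have := sum_instWeight_mul ρ p fun _ => 1
  simp only [mul_one] at this
  rw [this]
  simp

theorem batchWeight_eq (ρ : ℝ) (p : D) (y : α → D × Bool) :
    batchWeight ρ p y = (1 / (2 * Fintype.card D : ℝ)) ^ Fintype.card α * lik ρ p y := by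
  simp only [batchWeight, instWeight, lik, Finset.prod_div_distrib, Finset.prod_const,
    Finset.card_univ, one_div, inv_pow]
  ring

theorem batchWeight_nonneg {ρ : ℝ} (hρ₀ : 0 ≤ ρ) (hρ₁ : ρ ≤ 1) (p : D) (y : α → D × Bool) :
    0 ≤ batchWeight ρ p y :=
  Finset.prod_nonneg fun _ _ => instWeight_nonneg hρ₀ hρ₁ p _

theorem batchWeight_le {ρ : ℝ} (K : ℝ) (p : D) (y : α → D × Bool) :
    batchWeight ρ p y ≤ (1 / (2 * Fintype.card D : ℝ)) ^ Fintype.card α * (1 + excess ρ K p y) +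
      if (hits p y : ℝ) ≤ K then 0 else batchWeight ρ p y := by
  unfold excess
  split_ifs with h
  · rw [batchWeight_eq]; simp
  · have : 0 ≤ (1 / (2 * Fintype.card D : ℝ)) ^ Fintype.card α := by positivity
    linarith

variable [DecidableEq α]

/-- The truncation depends only on the locations, so averaging over fair signs still gives mean
zero. -/
theorem sum_excess (ρ K : ℝ) (p : D) : ∑ y : α → D × Bool, excess ρ K p y = 0 := by
  rw [sum_batches]
  refine Finset.sum_eq_zero fun Z _ => ?_
  by_cases h : (Fintype.card {t // Z t = p} : ℝ) ≤ K
  · simp only [excess, hits, h, if_true, lik, Finset.sum_sub_distrib]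
    rw [sum_prod_one_add_sgn fun t => if Z t = p then ρ else 0]
    simp
  · simp [excess, hits, h]

/-- Given the locations, the summands depend on disjoint blocks of signs, so the exponential moment
factorizes; each factor is centred and bounded by 1/2, and Hoeffding's lemma applies. -/
theorem sum_exp_excess_le {ρ K : ℝ} (hρ₀ : 0 ≤ ρ) (hρ₁ : ρ ≤ 1) (hK : ρ * K ≤ 1 / 4)
    (a : D → ℝ) :
    ∑ y : α → D × Bool, Real.exp (∑ p, a p * excess ρ K p y) ≤
      (2 * Fintype.card D : ℝ) ^ Fintype.card α * Real.exp ((∑ p, a p ^ 2) / 8) := by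
  rw [sum_batches]
  have key : ∀ Z : α → D, ∑ s : α → Bool,
      Real.exp (∑ p, a p * excess ρ K p fun t => (Z t, s t)) ≤
        2 ^ Fintype.card α * Real.exp ((∑ p, a p ^ 2) / 8) := by
    intro Z
    let G : ∀ p, ({t // Z t = p} → Bool) → ℝ := fun p u =>
      if (Fintype.card {t // Z t = p} : ℝ) ≤ K then ∏ t, (1 + ρ * sgn (u t)) - 1 else 0
    have hG : ∀ p (s : α → Bool), excess ρ K p (fun t => (Z t, s t)) = G p fun t => s t := by
      intro p s
      simp only [excess, lik_eq_prod_fibre, hits, G]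
    have hGb : ∀ p u, |G p u| ≤ 1 / 2 := by
      intro p u
      simp only [G]
      split_ifs with h
      · exact abs_prod_sub_one_le hρ₀ hρ₁ hK h u
      · norm_num
    have hG0 : ∀ p, ∑ u, G p u = 0 := by
      intro p
      simp only [G]
      split_ifs
      · rw [Finset.sum_sub_distrib, sum_prod_one_add_sgn fun _ => ρ]
        simp
      · simp
    have hcard : ∏ p, (Fintype.card ({t // Z t = p} → Bool) : ℝ) = 2 ^ Fintype.card α := by
      have := sum_prod_fibres Z fun _ _ => (1 : ℝ)
      simp only [Finset.prod_const_one, Finset.sum_const, Finset.card_univ, nsmul_eq_mul,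
        mul_one] at this
      rw [← this]; simp
    simp only [hG, Real.exp_sum]
    rw [sum_prod_fibres Z fun p u => Real.exp (a p * G p u)]
    calc _ ≤ ∏ p, (Fintype.card ({t // Z t = p} → Bool) * Real.exp (a p ^ 2 / 8)) :=
          Finset.prod_le_prod (fun p _ => Finset.sum_nonneg fun u _ => (Real.exp_pos _).le)
            fun p _ => sum_exp_le_of_abs_le (hGb p) (hG0 p) (a p)
      _ = _ := by rw [Finset.prod_mul_distrib, hcard, ← Real.exp_sum, Finset.sum_div]
  refine (Finset.sum_le_sum fun Z _ => key Z).trans (le_of_eq ?_)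
  rw [Finset.sum_const, Finset.card_univ, Fintype.card_fun, nsmul_eq_mul, mul_pow]
  push_cast
  ring

theorem sum_batchWeight [Nonempty D] (ρ : ℝ) (p : D) :
    ∑ y : α → D × Bool, batchWeight ρ p y = 1 := by
  simp only [batchWeight]
  rw [sum_prod_fun fun _ => instWeight ρ p]
  simp [sum_instWeight]

/-- In a batch of at most `|D|` instances, more than `K` hits at a location are unlikely. -/
theorem sum_batchWeight_hits_le [Nonempty D] {ρ : ℝ} (hρ₀ : 0 ≤ ρ) (hρ₁ : ρ ≤ 1)
    (hα : Fintype.card α ≤ Fintype.card D) (K : ℝ) (p : D) :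
    ∑ y : α → D × Bool, (if (hits p y : ℝ) ≤ K then 0 else batchWeight ρ p y) ≤
      8 * Real.exp (-K) := by
  -- Chernoff bound with the weight exp(hits - K). The bias alters only the sign, so the location
  -- remains uniform and the exponential moment is explicit.
  have hpt : ∀ y : α → D × Bool, (if (hits p y : ℝ) ≤ K then 0 else batchWeight ρ p y) ≤
      (∏ t, instWeight ρ p (y t) * (if (y t).1 = p then Real.exp 1 else 1)) *
        Real.exp (-K) := by
    intro y
    have e : ∏ t, (if (y t).1 = p then Real.exp 1 else 1) = Real.exp (hits p y) := by
      rw [Finset.prod_ite, Finset.prod_const, Finset.prod_const_one, mul_one, ← Real.exp_nat_mul,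
        mul_one, hits, Fintype.card_subtype]
    rw [Finset.prod_mul_distrib, e, mul_assoc, ← Real.exp_add]
    have hb := batchWeight_nonneg hρ₀ hρ₁ p y
    change _ ≤ batchWeight ρ p y * _
    split_ifs with h
    · positivity
    · have : 1 ≤ Real.exp (hits p y + -K) := Real.one_le_exp (by linarith)
      exact le_mul_of_one_le_right hb this
  refine (Finset.sum_le_sum fun y _ => hpt y).trans ?_
  rw [← Finset.sum_mul]
  refine mul_le_mul_of_nonneg_right ?_ (Real.exp_pos _).le
  rw [sum_prod_fun fun _ e => instWeight ρ p e * (if e.1 = p then Real.exp 1 else 1),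
    sum_instWeight_mul ρ p fun z => if z = p then Real.exp 1 else 1]
  have hN : (0 : ℝ) < Fintype.card D := by exact_mod_cast Fintype.card_pos
  have e : (∑ z : D, if z = p then Real.exp 1 else 1) = Fintype.card D + (Real.exp 1 - 1) := by
    have : ∀ z : D, (if z = p then Real.exp 1 else 1) =
        1 + if z = p then Real.exp 1 - 1 else 0 := by
      intro z; split_ifs <;> ring
    simp [this, Finset.sum_add_distrib]
  rw [e, Finset.prod_const, Finset.card_univ]
  have he := Real.exp_one_lt_d9
  have he' := Real.add_one_le_exp (1 : ℝ)
  calc _ ≤ Real.exp (2 / Fintype.card D) ^ Fintype.card α := by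
        have hx : ((Fintype.card D : ℝ) + (Real.exp 1 - 1)) / Fintype.card D ≤
            2 / Fintype.card D + 1 := by
          rw [div_add_one hN.ne']
          exact div_le_div_of_nonneg_right (by linarith) hN.le
        exact pow_le_pow_left₀ (div_nonneg (by linarith) hN.le)
          (hx.trans (Real.add_one_le_exp _)) _
    _ = Real.exp (2 * (Fintype.card α / Fintype.card D)) := by
        rw [← Real.exp_nat_mul]; congr 1; ring
    _ ≤ Real.exp (2 * 1) := by
        gcongr
        rw [div_le_one hN]; exact_mod_cast hα
    _ = Real.exp 1 * Real.exp 1 := by rw [← Real.exp_add]; norm_num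
    _ ≤ 8 := by nlinarith

/-- A chain which sees batches of at most `|D|` instances and whose steps have at most `B`
outcomes cannot locate the bias. -/
theorem sum_evolve_batch_le [Nonempty D] {S : Type*} {ρ K : ℝ} (hρ₀ : 0 ≤ ρ) (hρ₁ : ρ ≤ 1)
    (hK : ρ * K ≤ 1 / 4) (hα : Fintype.card α ≤ Fintype.card D)
    (F : ℕ → S → (α → D × Bool) → S) {B : ℕ} (hB : ∀ t s, (Set.range (F t s)).ncard ≤ B)
    (out : S → D) (M : ℕ) (s : S) :
    ∑ p, evolve F (batchWeight ρ p) 0 M (fun s => if out s = p then 1 else 0) s ≤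
      1 + Real.sqrt (4 * Fintype.card D * (M * Real.log B)) +
        Fintype.card D * (M * (8 * Real.exp (-K))) := by
  set μ : ℝ := (1 / (2 * Fintype.card D : ℝ)) ^ Fintype.card α with hμdef
  have hN : (0 : ℝ) < Fintype.card D := by exact_mod_cast Fintype.card_pos
  have hμ : 0 < μ := by positivity
  have hμ1 : ∑ _y : α → D × Bool, μ = 1 := sum_baseWeight
  have hlow : ∀ p (y : α → D × Bool), -(1 / 2) ≤ excess ρ K p y := fun p y =>
    (abs_le.1 (abs_excess_le hρ₀ hρ₁ hK p y)).1
  have hmean : ∀ p, ∑ y : α → D × Bool, μ * excess ρ K p y = 0 := fun p => by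
    rw [← Finset.mul_sum, sum_excess, mul_zero]
  have hmgf : ∀ a : D → ℝ, ∑ y : α → D × Bool, μ * Real.exp (∑ p, a p * excess ρ K p y) ≤
      Real.exp ((∑ p, a p ^ 2) / 8) := by
    intro a
    rw [← Finset.mul_sum]
    refine (mul_le_mul_of_nonneg_left (sum_exp_excess_le hρ₀ hρ₁ hK a) hμ.le).trans
      (le_of_eq ?_)
    rw [hμdef, ← mul_assoc, ← mul_pow, one_div_mul_cancel (by positivity), one_pow, one_mul]
  have main := sum_evolve_tilt_le F (μ := fun _ => μ) (fun _ => hμ) hμ1 hlow hmean hmgf hB out M s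
  have hstep : ∀ p, evolve F (batchWeight ρ p) 0 M (fun s => if out s = p then 1 else 0) s ≤
      evolve F (fun y => μ * (1 + excess ρ K p y)) 0 M (fun s => if out s = p then 1 else 0) s +
        M * (8 * Real.exp (-K)) := by
    intro p
    refine evolve_le_of_weight_le F (batchWeight_nonneg hρ₀ hρ₁ p) (sum_batchWeight ρ p)
      (fun y => mul_nonneg hμ.le (by linarith [hlow p y])) ?_
      (h := fun y => if (hits p y : ℝ) ≤ K then 0 else batchWeight ρ p y) ?_
      (sum_batchWeight_hits_le hρ₀ hρ₁ hα K p) (batchWeight_le K p) 0 M ?_ ?_ s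
    · simp only [mul_add, mul_one, Finset.sum_add_distrib, hμ1, hmean, add_zero]
    · intro y
      split_ifs
      exacts [le_rfl, batchWeight_nonneg hρ₀ hρ₁ p y]
    · intro s; split_ifs <;> norm_num
    · intro s; split_ifs <;> norm_num
  refine (Finset.sum_le_sum fun p _ => hstep p).trans ?_
  rw [Finset.sum_add_distrib, Finset.sum_const, Finset.card_univ, nsmul_eq_mul]
  -- The two sides differ only in the decidability instance.
  have e : (fun p : D => evolve F (fun y => μ * (1 + excess ρ K p y)) 0 M
      (fun s => if out s = p then 1 else 0) s) = fun p : D =>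
      evolve F (fun y => μ * (1 + excess ρ K p y)) 0 M
      (fun s => @ite ℝ (out s = p) (Classical.propDecidable _) 1 0) s := by
    funext p; congr 1; funext s; congr 1
  rw [e]
  exact add_le_add main le_rfl

/-- A batch of at most `|D|` instances does not determine the location of the bias. -/
theorem sum_batch_le [Nonempty D] {ρ K : ℝ} (hρ₀ : 0 ≤ ρ) (hρ₁ : ρ ≤ 1)
    (hK : ρ * K ≤ 1 / 4) (hα : Fintype.card α ≤ Fintype.card D) (out : (α → D × Bool) → D) :
    ∑ p, ∑ y, batchWeight ρ p y * (if out y = p then 1 else 0) ≤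
      3 / 2 + Fintype.card D * (8 * Real.exp (-K)) := by
  set μ : ℝ := (1 / (2 * Fintype.card D : ℝ)) ^ Fintype.card α with hμdef
  have hμ : 0 ≤ μ := by positivity
  have hμ1 : ∑ _y : α → D × Bool, μ = 1 := sum_baseWeight
  -- Off the truncated event, the batch law has density at most 3/2 with respect to the unbiased
  -- one.
  have hstep : ∀ p, ∑ y, batchWeight ρ p y * (if out y = p then 1 else 0) ≤
      ∑ y, (μ * (3 / 2)) * (if out y = p then 1 else 0) + 8 * Real.exp (-K) := by
    intro p
    refine le_trans ?_ (add_le_add le_rfl (sum_batchWeight_hits_le hρ₀ hρ₁ hα K p))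
    rw [← Finset.sum_add_distrib]
    refine Finset.sum_le_sum fun y _ => ?_
    have h1 := batchWeight_le (ρ := ρ) K p y
    have h2 := (abs_le.1 (abs_excess_le hρ₀ hρ₁ hK p y)).2
    have h3 : 0 ≤ if (hits p y : ℝ) ≤ K then 0 else batchWeight ρ p y := by
      split_ifs
      exacts [le_rfl, batchWeight_nonneg hρ₀ hρ₁ p y]
    by_cases h : out y = p
    · rw [if_pos h, mul_one, mul_one]
      exact h1.trans (add_le_add (mul_le_mul_of_nonneg_left (by linarith) hμ) le_rfl)
    · rw [if_neg h, mul_zero, mul_zero, zero_add]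
      exact h3
  refine (Finset.sum_le_sum fun p _ => hstep p).trans ?_
  rw [Finset.sum_add_distrib, Finset.sum_comm, Finset.sum_const, Finset.card_univ, nsmul_eq_mul]
  have : ∑ _y : α → D × Bool, μ * (3 / 2) = 3 / 2 := by rw [← Finset.sum_mul, hμ1, one_mul]
  simp only [mul_ite, mul_one, mul_zero, Finset.sum_ite_eq, Finset.mem_univ, if_true, this,
    le_refl]

end Batches

/-! ### Finite laws as measures, and averaging over the seed and the parameter -/

section FiniteLaws

variable {E X : Type*} [Fintype E] [MeasurableSpace E] [MeasurableSpace X]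

/-- The measure on a finite type with given weights. -/
noncomputable def finLaw (w : E → ℝ) : Measure E := ∑ e, ENNReal.ofReal (w e) • Measure.dirac e

instance (w : E → ℝ) : IsFiniteMeasure (finLaw w) := by
  constructor
  simp only [finLaw, Measure.coe_finsetSum, Finset.sum_apply, Measure.smul_apply]
  simp

theorem isProbabilityMeasure_finLaw {w : E → ℝ} (hw₀ : ∀ e, 0 ≤ w e) (hw : ∑ e, w e = 1) :
    IsProbabilityMeasure (finLaw w) := by
  constructor
  simp only [finLaw, Measure.coe_finsetSum, Finset.sum_apply, Measure.smul_apply]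
  simp [← ENNReal.ofReal_sum_of_nonneg fun e _ => hw₀ e, hw]

variable [MeasurableSingletonClass E]

theorem finLaw_singleton (w : E → ℝ) (e : E) : finLaw w {e} = ENNReal.ofReal (w e) := by
  classical
  simp [finLaw, Measure.dirac_apply' _ (measurableSet_singleton e), Set.indicator_apply]

theorem integral_finLaw {w : E → ℝ} (hw₀ : ∀ e, 0 ≤ w e) (f : E → ℝ) :
    ∫ e, f e ∂finLaw w = ∑ e, w e * f e := by
  rw [integral_fintype Integrable.of_finite]
  simp [Measure.real, finLaw_singleton, hw₀]

open Classical in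
theorem map_finLaw_real {w : E → ℝ} (hw₀ : ∀ e, 0 ≤ w e) {x : E → X} (hx : Measurable x)
    {A : Set X} (hA : MeasurableSet A) :
    ((finLaw w).map x).real A = ∑ e, w e * if x e ∈ A then 1 else 0 := by
  rw [map_measureReal_apply hx hA, ← integral_finLaw hw₀, ← integral_indicator_one (hx hA)]
  rfl

theorem pi_finLaw {α : Type*} [Fintype α] [DecidableEq α] {w : E → ℝ} (hw₀ : ∀ e, 0 ≤ w e) :
    (Measure.pi fun _ : α => finLaw w) = finLaw fun X : α → E => ∏ t, w (X t) := by
  refine Measure.ext_of_singleton fun X => ?_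
  rw [Measure.pi_singleton, finLaw_singleton, ENNReal.ofReal_prod_of_nonneg fun t _ => hw₀ _]
  simp only [finLaw_singleton]

end FiniteLaws

/-- If the success probabilities add up to at most `c` for every seed, then for some parameter
the average over the seed is at most the average of `c`. -/
theorem exists_prod_real_le {Ω X D : Type*} [MeasurableSpace Ω] [MeasurableSpace X]
    (ν : Measure Ω) [IsProbabilityMeasure ν] (P : Finset D) (hP : P.Nonempty)
    (law : D → Measure X) [∀ p, IsProbabilityMeasure (law p)] (A : D → Set (Ω × X))
    (hA : ∀ p, MeasurableSet (A p)) {c : ℝ}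
    (hc : ∀ ω, ∑ p ∈ P, (law p).real {x | (ω, x) ∈ A p} ≤ c) :
    ∃ p ∈ P, (ν.prod (law p)).real (A p) ≤ c / P.card := by
  have hsum : ∑ p ∈ P, ν.prod (law p) (A p) ≤ ENNReal.ofReal c := by
    simp only [Measure.prod_apply (hA _)]
    rw [← lintegral_finsetSum _ fun p _ => measurable_measure_prodMk_left (hA p)]
    calc _ ≤ ∫⁻ _ω, ENNReal.ofReal c ∂ν := by
          refine lintegral_mono fun ω => ?_
          have := ENNReal.ofReal_le_ofReal (hc ω)
          rw [ENNReal.ofReal_sum_of_nonneg fun p _ => measureReal_nonneg] at this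
          simpa [Measure.real, Set.preimage] using this
      _ = _ := by simp
  have hc0 : 0 ≤ c := by
    obtain ⟨ω⟩ : Nonempty Ω := nonempty_of_isProbabilityMeasure ν
    exact (Finset.sum_nonneg fun p _ => measureReal_nonneg).trans (hc ω)
  have hreal : ∑ p ∈ P, (ν.prod (law p)).real (A p) ≤ c := by
    have := ENNReal.toReal_mono ENNReal.ofReal_ne_top hsum
    rwa [ENNReal.toReal_sum fun p _ => measure_ne_top _ _, ENNReal.toReal_ofReal hc0] at this
  refine Finset.exists_le_of_sum_le hP (hreal.trans (le_of_eq ?_))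
  have : (P.card : ℝ) ≠ 0 := by exact_mod_cast hP.card_pos.ne'
  rw [Finset.sum_const, nsmul_eq_mul]
  field_simp

/-! ### Counting messages -/

section Messages

variable {b : ℕ}

/-- The exact count is 2^(b+1) - 1; the weaker 3^b equals 1 at b = 0 and has a logarithm linear in
b. -/
theorem finite_ncard_list_length_le (b : ℕ) :
    {l : List Bool | l.length ≤ b}.Finite ∧ {l : List Bool | l.length ≤ b}.ncard ≤ 3 ^ b := by
  induction b with
  | zero => simp
  | succ b ih =>
    have hsub : {l : List Bool | l.length ≤ b + 1} ⊆
        insert [] (List.cons true '' {l | l.length ≤ b} ∪ List.cons false '' {l | l.length ≤ b}) := by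
      rintro (_ | ⟨_ | _, l⟩) hl <;> simp_all
    have hfin := ((ih.1.image (List.cons true)).union (ih.1.image (List.cons false))).insert []
    refine ⟨hfin.subset hsub, (Set.ncard_le_ncard hsub hfin).trans ?_⟩
    have h1 := Set.ncard_insert_le ([] : List Bool)
      (List.cons true '' {l | l.length ≤ b} ∪ List.cons false '' {l | l.length ≤ b})
    have h2 := Set.ncard_union_le (List.cons true '' {l : List Bool | l.length ≤ b})
      (List.cons false '' {l | l.length ≤ b})
    have h3 := Set.ncard_image_le (f := List.cons true) ih.1
    have h4 := Set.ncard_image_le (f := List.cons false) ih.1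
    have h5 := ih.2
    have h6 := Nat.one_le_pow b 3 (by norm_num)
    rw [pow_succ]
    omega

instance : Finite (Message b) := (finite_ncard_list_length_le b).1

theorem card_message_le (b : ℕ) : Nat.card (Message b) ≤ 3 ^ b :=
  (finite_ncard_list_length_le b).2

instance : MeasurableSingletonClass (Message b) := ⟨fun _ => trivial⟩

instance : Nonempty (Message b) := ⟨⟨[], Nat.zero_le b⟩⟩

instance : Subsingleton (Message 0) := by
  constructor
  rintro ⟨l, hl⟩ ⟨l', hl'⟩
  exact Subtype.ext ((List.length_eq_zero_iff.1 (Nat.le_zero.1 hl)).trans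
    (List.length_eq_zero_iff.1 (Nat.le_zero.1 hl')).symm)

end Messages

/-! ### The lower bound for chains driven by short messages -/

section Chains

variable {D S : Type*} [DecidableEq D]

theorem evolve_indicator_nonneg {Y : Type*} [Fintype Y] (F : ℕ → S → Y → S) {w : Y → ℝ}
    (hw : ∀ y, 0 ≤ w y) (a n : ℕ) (out : S → D) (p : D) (s : S) :
    0 ≤ evolve F w a n (fun s => if out s = p then 1 else 0) s := by
  rw [evolve_eq_sum]
  refine Finset.sum_nonneg fun X _ => mul_nonneg (Finset.prod_nonneg fun t _ => hw _) ?_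
  split_ifs <;> norm_num

theorem sum_evolve_indicator [Fintype D] {Y : Type*} [Fintype Y] (F : ℕ → S → Y → S) {w : Y → ℝ}
    (hw1 : ∑ y, w y = 1) (a n : ℕ) (out : S → D) (s : S) :
    ∑ p, evolve F w a n (fun s => if out s = p then 1 else 0) s = 1 := by
  simp only [evolve_eq_sum]
  rw [Finset.sum_comm]
  simp only [← Finset.mul_sum, Finset.sum_ite_eq, Finset.mem_univ, if_true, mul_one,
    sum_prod_eq_one hw1]

theorem evolve_indicator_le_one [Fintype D] {Y : Type*} [Fintype Y] (F : ℕ → S → Y → S) {w : Y → ℝ}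
    (hw : ∀ y, 0 ≤ w y) (hw1 : ∑ y, w y = 1) (a n : ℕ) (out : S → D) (p : D) (s : S) :
    evolve F w a n (fun s => if out s = p then 1 else 0) s ≤ 1 := by
  refine le_of_le_of_eq ?_ (sum_evolve_indicator F hw1 a n out s)
  exact Finset.single_le_sum (f := fun p => evolve F w a n (fun s => if out s = p then 1 else 0) s)
    (fun p _ => evolve_indicator_nonneg F hw a n out p s) (Finset.mem_univ p)

/-- A chain which sees batches of at most `|D|` instances and whose steps are determined by
messages of `b` bits cannot locate the bias. -/
theorem sum_evolve_message_le [Fintype D] [Nonempty D] {α : Type*} [Fintype α]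
    [DecidableEq α] {ρ K : ℝ} (hρ₀ : 0 ≤ ρ) (hρ₁ : ρ ≤ 1)
    (hρK : ρ * K ≤ 1 / 4) (hK : Fintype.card D * Real.exp (-K) ≤ 1)
    (hα : Fintype.card α ≤ Fintype.card D) {b : ℕ}
    (f : ℕ → S → (α → D × Bool) → Message b) (next : ℕ → S → Message b → S)
    (out : S → D) (M : ℕ) (s : S) :
    ∑ p, evolve (fun t s y => next t s (f t s y)) (batchWeight ρ p) 0 M
      (fun s => if out s = p then 1 else 0) s ≤
      1 + 11 * Real.sqrt (Fintype.card D * M * b) := by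
  set N : ℝ := (Fintype.card D : ℝ) with hN
  have hN0 : 0 ≤ N := Nat.cast_nonneg _
  have hM0 : (0 : ℝ) ≤ M := Nat.cast_nonneg _
  -- For b = 0 the square root vanishes and could not absorb the truncation error; but then the
  -- steps ignore their inputs.
  rcases Nat.eq_zero_or_pos b with rfl | hb
  · obtain ⟨p₀⟩ := ‹Nonempty D›
    have : ∀ p, evolve (fun t s y => next t s (f t s y)) (batchWeight ρ p) 0 M =
        evolve (fun t s y => next t s (f t s y)) (batchWeight ρ p₀) 0 M := fun p => by
      funext φ
      exact evolve_congr_weight _ (fun t s y y' => by rw [Subsingleton.elim (f t s y) (f t s y')])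
        (sum_batchWeight ρ p) (sum_batchWeight ρ p₀) 0 M φ
    simp only [this, sum_evolve_indicator _ (sum_batchWeight ρ p₀)]
    simp
  · have hb1 : (1 : ℝ) ≤ b := by exact_mod_cast hb
    -- If M ≤ N, the truncation error 8M is at most 8√(NMb); if M > N, the trivial bound N on the
    -- sum is at most √(NMb).
    rcases le_or_gt (M : ℝ) N with hMN | hMN
    · have hB : ∀ t s, (Set.range fun y => next t s (f t s y)).ncard ≤ 3 ^ b := by
        intro t s
        have hsub : (Set.range fun y => next t s (f t s y)) ⊆ Set.range (next t s) := by
          rintro _ ⟨y, rfl⟩; exact ⟨_, rfl⟩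
        refine (Set.ncard_le_ncard hsub (Set.finite_range _)).trans ?_
        rw [← Set.image_univ]
        refine (Set.ncard_image_le Set.finite_univ).trans ?_
        rw [Set.ncard_univ]
        exact card_message_le b
      refine (sum_evolve_batch_le hρ₀ hρ₁ hρK hα _ hB out M s).trans ?_
      have hlog : Real.log ((3 ^ b : ℕ) : ℝ) ≤ 2 * b := by
        push_cast
        rw [Real.log_pow]
        have := Real.log_le_sub_one_of_pos (show (0 : ℝ) < 3 by norm_num)
        nlinarith
      have h1 : Real.sqrt (4 * N * (M * Real.log ((3 ^ b : ℕ) : ℝ))) ≤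
          3 * Real.sqrt (N * M * b) := by
        rw [show (3 : ℝ) = Real.sqrt 9 by
          rw [show (9 : ℝ) = 3 ^ 2 by norm_num, Real.sqrt_sq (by norm_num)],
          ← Real.sqrt_mul (by norm_num)]
        refine Real.sqrt_le_sqrt ?_
        have := mul_le_mul_of_nonneg_left hlog (mul_nonneg hN0 hM0)
        nlinarith [mul_nonneg (mul_nonneg hN0 hM0) (Nat.cast_nonneg (α := ℝ) b)]
      have h2 : (M : ℝ) ≤ Real.sqrt (N * M * b) := by
        refine Real.le_sqrt_of_sq_le ?_
        have := mul_le_mul_of_nonneg_right hMN hM0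
        nlinarith [mul_nonneg hN0 hM0]
      have h3 : N * (M * (8 * Real.exp (-K))) ≤ 8 * M := by
        nlinarith [mul_le_mul_of_nonneg_left hK hM0]
      linarith
    · have h1 : ∑ p, evolve (fun t s y => next t s (f t s y)) (batchWeight ρ p) 0 M
          (fun s => if out s = p then 1 else 0) s ≤ N := by
        refine (Finset.sum_le_sum fun p _ => evolve_indicator_le_one _
          (batchWeight_nonneg hρ₀ hρ₁ p) (sum_batchWeight ρ p) 0 M out p s).trans ?_
        simp [hN]
      have h2 : N ≤ Real.sqrt (N * M * b) := by
        refine Real.le_sqrt_of_sq_le ?_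
        have := mul_le_mul_of_nonneg_left hMN.le hN0
        nlinarith [mul_nonneg hN0 hM0]
      linarith

end Chains

/-! ### The hard distributions -/

section HardInstance

variable {d : ℕ}

/-- The vector `√(d/2) (e_i ± e_j)` given by the location `(i, j)` and the sign. -/
noncomputable def instVec (e : (Fin d × Fin d) × Bool) : Fin d → ℝ := fun k =>
  Real.sqrt (d / 2) * ((if k = e.1.1 then 1 else 0) + sgn e.2 * if k = e.1.2 then 1 else 0)

/-- The law of a random vector `√(d/2) (e_i ± e_j)` whose sign has bias `ρ` at the location `p`. -/
noncomputable def hardLaw (ρ : ℝ) (p : Fin d × Fin d) : Measure (Fin d → ℝ) :=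
  (finLaw (instWeight ρ p)).map instVec

theorem measurable_instVec : Measurable (instVec : (Fin d × Fin d) × Bool → Fin d → ℝ) :=
  measurable_of_finite _

theorem nonempty_pair (p : Fin d × Fin d) : Nonempty (Fin d × Fin d) := ⟨p⟩

theorem isProbabilityMeasure_hardLaw {ρ : ℝ} (hρ₀ : 0 ≤ ρ) (hρ₁ : ρ ≤ 1) (p : Fin d × Fin d) :
    IsProbabilityMeasure (hardLaw ρ p) := by
  have := nonempty_pair p
  have := isProbabilityMeasure_finLaw (instWeight_nonneg hρ₀ hρ₁ p) (sum_instWeight ρ p)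
  exact Measure.isProbabilityMeasure_map measurable_instVec.aemeasurable

theorem iidLaw_hardLaw {ρ : ℝ} (hρ₀ : 0 ≤ ρ) (hρ₁ : ρ ≤ 1) (p : Fin d × Fin d) (n : ℕ) :
    iidLaw (hardLaw ρ p) n = (finLaw (batchWeight ρ p)).map
      fun (y : Fin n → (Fin d × Fin d) × Bool) t => instVec (y t) := by
  have := isProbabilityMeasure_hardLaw hρ₀ hρ₁ p
  unfold hardLaw at this
  rw [iidLaw]
  unfold hardLaw
  rw [← Measure.pi_map_pi fun _ => measurable_instVec.aemeasurable,
    pi_finLaw (instWeight_nonneg hρ₀ hρ₁ p)]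
  rfl

theorem pi_iidLaw_hardLaw {ρ : ℝ} (hρ₀ : 0 ≤ ρ) (hρ₁ : ρ ≤ 1) (p : Fin d × Fin d) (n M : ℕ) :
    (Measure.pi fun _ : Fin M => iidLaw (hardLaw ρ p) n) =
      (finLaw fun X : Fin M → Fin n → (Fin d × Fin d) × Bool => ∏ t, batchWeight ρ p (X t)).map
        fun X t k => instVec (X t k) := by
  have := isProbabilityMeasure_hardLaw hρ₀ hρ₁ p
  have h : IsProbabilityMeasure (iidLaw (hardLaw ρ p) n) := inferInstance
  rw [iidLaw_hardLaw hρ₀ hρ₁] at h ⊢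
  rw [← Measure.pi_map_pi fun _ => (measurable_of_finite _).aemeasurable,
    pi_finLaw (batchWeight_nonneg hρ₀ hρ₁ p)]

end HardInstance

/-! ### Success of the plug-in estimator -/

section PlugIn

variable {d m : ℕ} {P : Measure (Fin d → ℝ)} {τ : ℝ} {p : Fin d × Fin d}

theorem two_mul_card_pairs (d : ℕ) :
    2 * (Finset.univ.filter fun p : Fin d × Fin d => p.1 < p.2).card + d = d * d := by
  have h1 : (Finset.univ.filter fun p : Fin d × Fin d => p.1 < p.2).card =
      (Finset.univ.filter fun p : Fin d × Fin d => p.2 < p.1).card :=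
    Finset.card_equiv (Equiv.prodComm _ _) (by simp)
  have h2 : (Finset.univ.filter fun p : Fin d × Fin d => p.1 = p.2).card = d := by
    refine Eq.trans (Finset.card_bij (s := (Finset.univ : Finset (Fin d))) (fun i _ => (i, i))
      (fun i _ => by simp) (fun i _ j _ h => (Prod.mk.inj h).1) ?_).symm (Finset.card_fin d)
    rintro ⟨i, j⟩ h
    simp only [Finset.mem_filter, Finset.mem_univ, true_and] at h
    exact ⟨i, Finset.mem_univ _, by rw [h]⟩
  have h3 : (Finset.univ : Finset (Fin d × Fin d)) =
      ((Finset.univ.filter fun p : Fin d × Fin d => p.1 < p.2) ∪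
        (Finset.univ.filter fun p : Fin d × Fin d => p.2 < p.1)) ∪
        (Finset.univ.filter fun p : Fin d × Fin d => p.1 = p.2) := by
    ext q
    have := lt_trichotomy q.1 q.2
    simp only [Finset.mem_univ, Finset.mem_union, Finset.mem_filter, true_and, true_iff]
    tauto
  have h4 := congrArg Finset.card h3
  rw [Finset.card_union_of_disjoint, Finset.card_union_of_disjoint, ← h1, h2] at h4
  · simp only [Finset.card_univ, Fintype.card_prod, Fintype.card_fin] at h4
    omega
  · rw [Finset.disjoint_filter]
    intro q _ h
    exact h.le.not_gt
  · rw [Finset.disjoint_left]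
    intro q hq
    simp only [Finset.mem_union, Finset.mem_filter, Finset.mem_univ, true_and] at hq ⊢
    rcases hq with h | h
    exacts [h.ne, h.ne']

theorem plugIn_success (h : IsPairCorrelated P τ p) (hc : Concentrates m P τ)
    {est : Sample m d → Fin d × Fin d} (hest : IsPlugIn est) :
    1 - (d : ℝ) ^ 2 * Real.exp (-((m : ℝ) * τ ^ 2 / 6)) ≤ (iidLaw P m).real {x | est x = p} := by
  have := h.isProbabilityMeasure
  set pairs := Finset.univ.filter fun p : Fin d × Fin d => p.1 < p.2 with hpairs
  set bad : Fin d × Fin d → Set (Sample m d) := fun q =>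
    {x | τ / 2 ≤ |empAvg x q.1 q.2 - ∫ y, y q.1 * y q.2 ∂P|} with hbad
  have hcover : (Set.univ : Set (Sample m d)) ⊆ {x | est x = p} ∪ ⋃ q ∈ pairs, bad q := by
    intro x _
    by_cases hx : ∃ q ∈ pairs, x ∈ bad q
    · right
      simpa using hx
    · left
      push Not at hx
      by_contra hne
      obtain ⟨hlt, hmax⟩ := hest x
      have h1 := hx p (by simp [hpairs, h.ordered])
      have h2 := hx (est x) (by simp [hpairs, hlt])
      have h3 := hmax p.1 p.2 h.ordered
      simp only [hbad, Set.mem_ofPred_eq, not_le] at h1 h2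
      rw [h.correlated] at h1
      rw [h.uncorrelated _ _ hlt hne] at h2
      have h1 := (abs_lt.1 h1).1
      have h2 := (abs_lt.1 h2).2
      linarith
  have hle : (1 : ℝ) ≤ (iidLaw P m).real {x | est x = p} +
      ∑ q ∈ pairs, (iidLaw P m).real (bad q) := by
    have h1 : (iidLaw P m).real Set.univ = 1 := probReal_univ
    rw [← h1]
    refine (measureReal_mono hcover).trans ((measureReal_union_le _ _).trans ?_)
    exact add_le_add le_rfl (measureReal_biUnion_finset_le _ _)
  have hsum : ∑ q ∈ pairs, (iidLaw P m).real (bad q) ≤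
      pairs.card * (2 * Real.exp (-((m : ℝ) * τ ^ 2 / 6))) := by
    rw [← nsmul_eq_mul]
    refine Finset.sum_le_card_nsmul _ _ _ fun q hq => hc q.1 q.2 ?_
    simpa [hpairs] using hq
  -- The factor 2 of the two-sided tail is absorbed because only about half of all d² index pairs
  -- are ordered.
  have hcard : 2 * (pairs.card : ℝ) ≤ (d : ℝ) ^ 2 := by
    have := two_mul_card_pairs d
    rw [sq]
    exact_mod_cast (Nat.le_add_right _ _).trans this.le
  have := mul_le_mul_of_nonneg_right hcard (Real.exp_pos (-((m : ℝ) * τ ^ 2 / 6))).le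
  linarith

theorem plugIn_success_of_biasOfOrder {c₁ c₂ : ℝ} (hc₁ : 0 < c₁) (hd : 9 ≤ d)
    (h : IsPairCorrelated P τ p) (hc : Concentrates m P τ) (hτ : BiasOfOrder c₁ c₂ d τ)
    {est : Sample m d → Fin d × Fin d} (hest : IsPlugIn est) :
    1 - (d : ℝ) ^ 2 *
        Real.exp (-(c₁ ^ 2 / 6 * ((m : ℝ) / ((d : ℝ) ^ 2 * Real.log d ^ 2)))) ≤
      (iidLaw P m).real {x | est x = p} := by
  refine le_trans ?_ (plugIn_success h hc hest)
  have hd' : (1 : ℝ) < d := by exact_mod_cast (by omega : 1 < d)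
  have hlog : 0 < Real.log d := Real.log_pos hd'
  have h1 : (c₁ / ((d : ℝ) * Real.log d)) ^ 2 ≤ τ ^ 2 :=
    pow_le_pow_left₀ (by positivity) hτ.1 2
  have h2 : c₁ ^ 2 / 6 * ((m : ℝ) / ((d : ℝ) ^ 2 * Real.log d ^ 2)) =
      m * (c₁ / ((d : ℝ) * Real.log d)) ^ 2 / 6 := by
    field_simp
  rw [h2]
  gcongr

end PlugIn

/-! ### Second moments of the hard distributions -/

section Moments

variable {d : ℕ} {ρ : ℝ} {p : Fin d × Fin d}

theorem sum_instWeight_mul_sgn {D : Type*} [Fintype D] [DecidableEq D] (ρ : ℝ) (p : D)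
    (f : D → ℝ) :
    ∑ e, instWeight ρ p e * (f e.1 * sgn e.2) = ρ * f p / Fintype.card D := by
  rw [Fintype.sum_prod_type]
  have h : ∀ z : D, ∑ s, instWeight ρ p (z, s) * (f z * sgn s) =
      if z = p then ρ * f z / Fintype.card D else 0 := by
    intro z
    simp only [instWeight, Fintype.sum_bool, sgn]
    by_cases hz : z = p
    · simp [hz]; ring
    · simp [hz]
  simp only [h, Finset.sum_ite_eq', Finset.mem_univ, if_true]

/-- The indicator that the location `z` is `(i, j)` or `(j, i)`. -/
def pairInd (i j : Fin d) (z : Fin d × Fin d) : ℝ :=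
  (if z = (i, j) then 1 else 0) + if z = (j, i) then 1 else 0

theorem pairInd_sq {i j : Fin d} (hij : i < j) (z : Fin d × Fin d) :
    pairInd i j z ^ 2 = pairInd i j z := by
  unfold pairInd
  split_ifs with h1 h2
  · rw [h1, Prod.mk.injEq] at h2
    exact absurd h2.1 hij.ne
  all_goals norm_num

theorem sum_pairInd (i j : Fin d) : ∑ z, pairInd i j z = 2 := by
  simp only [pairInd, Finset.sum_add_distrib, Finset.sum_ite_eq', Finset.mem_univ, if_true]
  norm_num

theorem instVec_mul {i j : Fin d} (hij : i < j) (e : (Fin d × Fin d) × Bool) :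
    instVec e i * instVec e j = d / 2 * (pairInd i j e.1 * sgn e.2) := by
  have hs : Real.sqrt ((d : ℝ) / 2) * Real.sqrt (d / 2) = d / 2 :=
    Real.mul_self_sqrt (by positivity)
  have : instVec e i * instVec e j = (Real.sqrt ((d : ℝ) / 2) * Real.sqrt (d / 2)) *
      (((if i = e.1.1 then 1 else 0) + sgn e.2 * if i = e.1.2 then 1 else 0) *
        ((if j = e.1.1 then 1 else 0) + sgn e.2 * if j = e.1.2 then 1 else 0)) := by
    unfold instVec; ring
  rw [this, hs]
  congr 1
  obtain ⟨⟨z₁, z₂⟩, s⟩ := e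
  have hne := hij.ne
  by_cases a1 : i = z₁ <;> by_cases a2 : i = z₂ <;> by_cases a3 : j = z₁ <;>
    by_cases a4 : j = z₂ <;> simp_all [pairInd, eq_comm]

/-- The last term comes from the diagonal location (i, i), where the two basis vectors double or
cancel; it has mean zero when p is off the diagonal. -/
theorem instVec_sq (i : Fin d) (e : (Fin d × Fin d) × Bool) :
    instVec e i ^ 2 = d / 2 * ((if i = e.1.1 then 1 else 0) + if i = e.1.2 then 1 else 0) +
      (if e.1 = (i, i) then (d : ℝ) else 0) * sgn e.2 := by
  have hs : Real.sqrt ((d : ℝ) / 2) ^ 2 = d / 2 := Real.sq_sqrt (by positivity)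
  have hsg : sgn e.2 ^ 2 = 1 := by rw [← sq_abs, abs_sgn, one_pow]
  unfold instVec
  rw [mul_pow, hs]
  obtain ⟨⟨z₁, z₂⟩, s⟩ := e
  simp only [Prod.mk.injEq] at hsg ⊢
  by_cases a1 : i = z₁
  · by_cases a2 : i = z₂
    · subst a1; simp [← a2]; linear_combination (d : ℝ) / 2 * hsg
    · simp [a1, eq_comm, a1 ▸ a2]
  · by_cases a2 : i = z₂
    · simp [← a2, a1, eq_comm, hsg]
    · simp [a1, a2, eq_comm]

theorem integral_hardLaw (hρ₀ : 0 ≤ ρ) (hρ₁ : ρ ≤ 1) {f : (Fin d → ℝ) → ℝ} (hf : Measurable f) :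
    ∫ x, f x ∂hardLaw ρ p = ∑ e, instWeight ρ p e * f (instVec e) := by
  rw [hardLaw, integral_map measurable_instVec.aemeasurable hf.aestronglyMeasurable,
    integral_finLaw (instWeight_nonneg hρ₀ hρ₁ p)]

/-- Both (i, j) and (j, i) are locations, but only p carries a bias, which yields (d/2) · ρ/d² =
ρ/(2d). -/
theorem sum_instWeight_mul_instVec (hp : p.1 < p.2) {i j : Fin d} (hij : i < j) :
    ∑ e, instWeight ρ p e * (instVec e i * instVec e j) =
      if (i, j) = p then ρ / (2 * d) else 0 := by
  have hd : (0 : ℝ) < d := by exact_mod_cast Fin.pos i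
  simp only [instVec_mul hij, ← mul_assoc (d / 2 : ℝ)]
  rw [sum_instWeight_mul_sgn ρ p fun z => d / 2 * pairInd i j z]
  have hne : p ≠ (j, i) := by
    rintro rfl
    exact hij.not_gt hp
  simp only [pairInd, hne, if_false, Fintype.card_prod, Fintype.card_fin]
  by_cases h : p = (i, j)
  · rw [if_pos h, if_pos h.symm]; push_cast; field_simp; ring
  · rw [if_neg h, if_neg (Ne.symm h)]; simp

theorem isPairCorrelated_hardLaw (hρ₀ : 0 < ρ) (hρ₁ : ρ ≤ 1) (hp : p.1 < p.2) :
    IsPairCorrelated (hardLaw ρ p) (ρ / (2 * d)) p := by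
  have hd : (0 : ℝ) < d := by exact_mod_cast Fin.pos p.1
  have hprod : ∀ i j : Fin d, Measurable fun x : Fin d → ℝ => x i * x j := fun i j =>
    (measurable_pi_apply i).mul (measurable_pi_apply j)
  refine ⟨isProbabilityMeasure_hardLaw hρ₀.le hρ₁ p, fun i => ?_, hp, by positivity, ?_, ?_⟩
  · rw [integral_hardLaw hρ₀.le hρ₁ ((measurable_pi_apply i).pow_const 2)]
    simp only [instVec_sq, mul_add, Finset.sum_add_distrib]
    rw [sum_instWeight_mul_sgn ρ p fun z => if z = (i, i) then (d : ℝ) else 0,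
      sum_instWeight_mul ρ p fun z => (d / 2 : ℝ) * if i = z.1 then 1 else 0,
      sum_instWeight_mul ρ p fun z => (d / 2 : ℝ) * if i = z.2 then 1 else 0]
    have hne : p ≠ (i, i) := by
      rintro rfl
      exact lt_irrefl _ hp
    have h1 : ∑ z : Fin d × Fin d, (d / 2 : ℝ) * (if i = z.1 then 1 else 0) = d / 2 * d := by
      rw [← Finset.mul_sum, Fintype.sum_prod_type_right]; simp
    have h2 : ∑ z : Fin d × Fin d, (d / 2 : ℝ) * (if i = z.2 then 1 else 0) = d / 2 * d := by
      rw [← Finset.mul_sum, Fintype.sum_prod_type]; simp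
    simp only [hne, if_false, h1, h2, Fintype.card_prod, Fintype.card_fin, mul_zero, zero_div,
      add_zero]
    push_cast
    field_simp
    ring
  · rw [integral_hardLaw hρ₀.le hρ₁ (hprod _ _), sum_instWeight_mul_instVec hp hp, if_pos rfl]
  · intro i j hij hne
    rw [integral_hardLaw hρ₀.le hρ₁ (hprod _ _), sum_instWeight_mul_instVec hp hij, if_neg hne]

end Moments

/-! ### Concentration of the empirical correlations -/

section Concentration

/-- The Taylor remainder is at most (2/9)|x|³, and 1/2 + 2/9 ≤ 3/4. -/
theorem exp_le_quadratic {x : ℝ} (hx : |x| ≤ 1) : Real.exp x ≤ 1 + x + 3 / 4 * x ^ 2 := by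
  have h := (abs_le.1 (Real.exp_bound hx (n := 3) (by norm_num))).2
  simp only [Finset.sum_range_succ, Finset.sum_range_zero, Nat.factorial] at h
  norm_num at h
  have h3 : |x| ^ 3 ≤ x ^ 2 := by
    rw [← sq_abs x]
    nlinarith [sq_nonneg |x|, abs_nonneg x]
  linarith [sq_nonneg x]

/-- A centred moment generating function bound from the first two moments. -/
theorem sum_exp_centred_le {E : Type*} [Fintype E] {w : E → ℝ} (hw₀ : ∀ e, 0 ≤ w e)
    (hw : ∑ e, w e = 1) {Y : E → ℝ} {lam : ℝ} (hY : ∀ e, |lam * Y e| ≤ 1) :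
    ∑ e, w e * Real.exp (lam * (Y e - ∑ e, w e * Y e)) ≤
      Real.exp (3 / 4 * lam ^ 2 * ∑ e, w e * Y e ^ 2) := by
  set μ := ∑ e, w e * Y e with hμ
  set v := ∑ e, w e * Y e ^ 2 with hv
  have h1 : ∑ e, w e * Real.exp (lam * Y e) ≤ 1 + lam * μ + 3 / 4 * lam ^ 2 * v := by
    calc _ ≤ ∑ e, w e * (1 + lam * Y e + 3 / 4 * (lam * Y e) ^ 2) :=
          Finset.sum_le_sum fun e _ =>
            mul_le_mul_of_nonneg_left (exp_le_quadratic (hY e)) (hw₀ e)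
      _ = _ := by
          rw [hμ, hv, Finset.mul_sum, Finset.mul_sum]
          conv_rhs => rw [← hw, ← Finset.sum_add_distrib, ← Finset.sum_add_distrib]
          exact Finset.sum_congr rfl fun e _ => by ring
  have h2 : ∀ e, w e * Real.exp (lam * (Y e - μ)) =
      w e * Real.exp (lam * Y e) * Real.exp (-(lam * μ)) := by
    intro e
    rw [mul_assoc, ← Real.exp_add]; congr 2; ring
  simp only [h2]
  rw [← Finset.sum_mul]
  have h3 := Real.add_one_le_exp (lam * μ + 3 / 4 * lam ^ 2 * v)
  calc _ ≤ Real.exp (lam * μ + 3 / 4 * lam ^ 2 * v) * Real.exp (-(lam * μ)) := by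
        refine mul_le_mul_of_nonneg_right ?_ (Real.exp_pos _).le
        linarith
    _ = _ := by rw [← Real.exp_add]; congr 1; ring

open Classical in
/-- Chernoff's bound for variables with second moment `1 / 2`. -/
theorem sum_deviation_le {E : Type*} [Fintype E] {w : E → ℝ} (hw₀ : ∀ e, 0 ≤ w e)
    (hw : ∑ e, w e = 1) {Y : E → ℝ} {τ : ℝ} (hτ : 0 < τ) (hY : ∀ e, |2 / 3 * τ * Y e| ≤ 1)
    (hv : ∑ e, w e * Y e ^ 2 = 1 / 2) (k : ℕ) :
    ∑ X : Fin k → E, (∏ t, w (X t)) *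
        (if τ / 2 ≤ |(∑ t, Y (X t)) / k - ∑ e, w e * Y e| then 1 else 0) ≤
      2 * Real.exp (-((k : ℝ) * τ ^ 2 / 6)) := by
  set μ := ∑ e, w e * Y e with hμ
  -- The choice |λ| = 2τ/3 minimizes the exponent (3/8)λ² - |λ|τ/2 per instance, with value τ²/6 -
  -- τ²/3 = -τ²/6.
  have side : ∀ lam : ℝ, |lam| = 2 / 3 * τ →
      ∑ X : Fin k → E, (∏ t, w (X t)) * Real.exp (lam * ∑ t, (Y (X t) - μ)) ≤
        Real.exp (k * (τ ^ 2 / 6)) := by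
    intro lam hlam
    have hl : ∀ e, |lam * Y e| ≤ 1 := by
      intro e
      have := hY e
      rwa [abs_mul, abs_of_pos (by positivity), ← hlam, ← abs_mul] at this
    have h := sum_exp_centred_le hw₀ hw hl
    have hsq : lam ^ 2 = 4 / 9 * τ ^ 2 := by rw [← sq_abs, hlam]; ring
    rw [hv, hsq] at h
    have e1 : ∀ X : Fin k → E, (∏ t, w (X t)) * Real.exp (lam * ∑ t, (Y (X t) - μ)) =
        ∏ t, w (X t) * Real.exp (lam * (Y (X t) - μ)) := by
      intro X
      rw [Finset.prod_mul_distrib, ← Real.exp_sum, Finset.mul_sum]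
    simp only [e1]
    rw [sum_prod_fun fun _ e => w e * Real.exp (lam * (Y e - μ)), Finset.prod_const,
      Finset.card_univ, Fintype.card_fin, Real.exp_nat_mul]
    refine pow_le_pow_left₀
      (Finset.sum_nonneg fun e _ => mul_nonneg (hw₀ e) (Real.exp_pos _).le) (h.trans_eq ?_) k
    congr 1; ring
  have hpt : ∀ X : Fin k → E, (if τ / 2 ≤ |(∑ t, Y (X t)) / k - μ| then (1 : ℝ) else 0) ≤
      (Real.exp (2 / 3 * τ * ∑ t, (Y (X t) - μ)) + Real.exp (-(2 / 3 * τ) * ∑ t, (Y (X t) - μ))) *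
        Real.exp (-(k * (τ ^ 2 / 3))) := by
    intro X
    split_ifs with h
    · have hS : k * (τ / 2) ≤ |∑ t, (Y (X t) - μ)| := by
        rw [Finset.sum_sub_distrib, Finset.sum_const, Finset.card_univ, Fintype.card_fin,
          nsmul_eq_mul]
        rcases Nat.eq_zero_or_pos k with rfl | hk
        · simp
        · have hk' : (0 : ℝ) < k := by exact_mod_cast hk
          calc (k : ℝ) * (τ / 2) ≤ k * |(∑ t, Y (X t)) / k - μ| := by gcongr
            _ = |k * ((∑ t, Y (X t)) / k - μ)| := by rw [abs_mul, abs_of_pos hk']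
            _ = _ := by congr 1; field_simp
      rw [add_mul, ← Real.exp_add, ← Real.exp_add]
      rcases le_abs.1 hS with h' | h'
      · have : 1 ≤ Real.exp (2 / 3 * τ * ∑ t, (Y (X t) - μ) + -(k * (τ ^ 2 / 3))) :=
          Real.one_le_exp (by nlinarith)
        have := Real.exp_pos (-(2 / 3 * τ) * ∑ t, (Y (X t) - μ) + -(k * (τ ^ 2 / 3)))
        linarith
      · have : 1 ≤ Real.exp (-(2 / 3 * τ) * ∑ t, (Y (X t) - μ) + -(k * (τ ^ 2 / 3))) :=
          Real.one_le_exp (by nlinarith)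
        have := Real.exp_pos (2 / 3 * τ * ∑ t, (Y (X t) - μ) + -(k * (τ ^ 2 / 3)))
        linarith
    · positivity
  calc _ ≤ ∑ X : Fin k → E, (∏ t, w (X t)) *
        ((Real.exp (2 / 3 * τ * ∑ t, (Y (X t) - μ)) +
          Real.exp (-(2 / 3 * τ) * ∑ t, (Y (X t) - μ))) * Real.exp (-(k * (τ ^ 2 / 3)))) :=
        Finset.sum_le_sum fun X _ => mul_le_mul_of_nonneg_left (hpt X)
          (Finset.prod_nonneg fun t _ => hw₀ _)
    _ = (∑ X : Fin k → E, (∏ t, w (X t)) * Real.exp (2 / 3 * τ * ∑ t, (Y (X t) - μ)) +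
          ∑ X : Fin k → E, (∏ t, w (X t)) * Real.exp (-(2 / 3 * τ) * ∑ t, (Y (X t) - μ))) *
        Real.exp (-(k * (τ ^ 2 / 3))) := by
        rw [← Finset.sum_add_distrib, Finset.sum_mul]
        exact Finset.sum_congr rfl fun X _ => by ring
    _ ≤ (Real.exp (k * (τ ^ 2 / 6)) + Real.exp (k * (τ ^ 2 / 6))) *
        Real.exp (-(k * (τ ^ 2 / 3))) := by
        refine mul_le_mul_of_nonneg_right (add_le_add (side _ ?_) (side _ ?_)) (Real.exp_pos _).le
        · exact abs_of_pos (by positivity)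
        · rw [abs_neg]; exact abs_of_pos (by positivity)
    _ = _ := by rw [← two_mul, mul_assoc, ← Real.exp_add]; congr 2; ring

variable {d : ℕ} {ρ : ℝ} {p : Fin d × Fin d}

/-- The product of two coordinates is 0 or ±d/2 and is nonzero with probability 2/d², so its second
moment is exactly 1/2 for every pair, biased or not; scaled by 2τ/3 it is at most ρ/6. -/
theorem concentrates_hardLaw (hρ₀ : 0 < ρ) (hρ₁ : ρ ≤ 1) (k : ℕ) :
    Concentrates k (hardLaw ρ p) (ρ / (2 * d)) := by
  classical
  intro i j hij
  have := nonempty_pair p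
  have hd : (0 : ℝ) < d := by exact_mod_cast Fin.pos i
  have hprod : Measurable fun x : Fin d → ℝ => x i * x j :=
    (measurable_pi_apply i).mul (measurable_pi_apply j)
  have hmeas : MeasurableSet {x : Sample k d |
      ρ / (2 * d) / 2 ≤ |empAvg x i j - ∫ y, y i * y j ∂hardLaw ρ p|} := by
    refine measurableSet_le measurable_const ?_
    unfold empAvg
    fun_prop
  rw [iidLaw_hardLaw hρ₀.le hρ₁,
    map_finLaw_real (batchWeight_nonneg hρ₀.le hρ₁ p) (measurable_of_finite _) hmeas]
  simp only [integral_hardLaw hρ₀.le hρ₁ hprod, Set.mem_ofPred_eq, empAvg]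
  refine sum_deviation_le (w := instWeight ρ p) (Y := fun e => instVec e i * instVec e j)
    (instWeight_nonneg hρ₀.le hρ₁ p) (sum_instWeight ρ p) (by positivity) ?_ ?_ k
  · intro e
    have hind : |pairInd i j e.1| ≤ 1 := by
      have := pairInd_sq hij e.1
      rw [abs_le]; constructor <;> nlinarith
    rw [instVec_mul hij, show 2 / 3 * (ρ / (2 * d)) * (d / 2 * (pairInd i j e.1 * sgn e.2)) =
      ρ / 6 * pairInd i j e.1 * sgn e.2 by field_simp; ring, abs_mul, abs_mul, abs_sgn, mul_one,
      abs_of_pos (by positivity)]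
    nlinarith [abs_nonneg (pairInd i j e.1)]
  · have e : ∀ e : (Fin d × Fin d) × Bool, (instVec e i * instVec e j) ^ 2 =
        (d : ℝ) ^ 2 / 4 * pairInd i j e.1 := by
      intro e
      rw [instVec_mul hij, mul_pow, mul_pow, pairInd_sq hij, ← sq_abs (sgn e.2), abs_sgn]
      ring
    simp only [e]
    rw [sum_instWeight_mul ρ p fun z => (d : ℝ) ^ 2 / 4 * pairInd i j z, ← Finset.mul_sum,
      sum_pairInd, Fintype.card_prod, Fintype.card_fin]
    push_cast
    field_simp
    norm_num

end Concentration

/-! ### Measurability of the estimates -/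

section Measurability

variable {Ω : Type u} [MeasurableSpace Ω] {b n m d : ℕ}

theorem Protocol.measurable_transcript (A : Protocol Ω b n m d) (t : ℕ) (ht : t ≤ m) :
    Measurable fun z : Ω × (Fin m → Sample n d) => A.transcript z.1 z.2 t ht := by
  induction t with
  | zero => exact measurable_pi_iff.2 fun i => i.elim0
  | succ t ih =>
    have ih := ih (Nat.le_of_succ_le ht)
    refine measurable_pi_iff.2 fun i => ?_
    refine Fin.lastCases ?_ (fun i => ?_) i
    · simp only [Protocol.transcript, Fin.snoc_last]
      have hX : Measurable fun z : Ω × (Fin m → Sample n d) => z.2 ⟨t, ht⟩ :=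
        (measurable_pi_apply _).comp measurable_snd
      exact (A.measurable_msg ⟨t, ht⟩).comp (measurable_fst.prodMk (hX.prodMk ih))
    · simp only [Protocol.transcript, Fin.snoc_castSucc]
      exact (measurable_pi_apply i).comp ih

theorem Protocol.measurable_estimate (A : Protocol Ω b n m d) :
    Measurable fun z : Ω × (Fin m → Sample n d) => A.estimate z.1 z.2 :=
  A.measurable_out.comp (measurable_fst.prodMk (A.measurable_transcript m le_rfl))

theorem measurable_foldl {Z W : Type*} [MeasurableSpace Z] [MeasurableSpace W] (n : ℕ)
    (f : Fin n → Z → W → W) (hf : ∀ t, Measurable fun z : Z × W => f t z.1 z.2) {g : Z → W}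
    (hg : Measurable g) : Measurable fun z => Fin.foldl n (fun w t => f t z w) (g z) := by
  induction n with
  | zero => simpa using hg
  | succ n ih =>
    simp only [Fin.foldl_succ_last]
    exact (hf (Fin.last n)).comp (measurable_id.prodMk
      (ih (fun t => f t.castSucc) fun t => hf t.castSucc))

theorem OnlineProtocol.measurable_estimate (A : OnlineProtocol Ω b m d) :
    Measurable fun z : Ω × Sample m d => A.estimate z.1 z.2 := by
  refine A.measurable_out.comp (measurable_fst.prodMk
    (measurable_foldl m (fun t (z : Ω × Sample m d) w => A.update t z.1 (z.2 t) w)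
      (fun t => ?_) (A.measurable_init.comp measurable_fst)))
  have hω : Measurable fun z : (Ω × Sample m d) × Message b => z.1.1 :=
    measurable_fst.comp measurable_fst
  have hx : Measurable fun z : (Ω × Sample m d) × Message b => z.1.2 t :=
    (measurable_pi_apply t).comp (measurable_snd.comp measurable_fst)
  exact (A.measurable_update t).comp (hω.prodMk (hx.prodMk measurable_snd))

end Measurability

/-! ### Protocols as chains -/

section Reduction

variable {Ω : Type u} [MeasurableSpace Ω] {b n m d : ℕ}

/-- The update rule of the transcript of a protocol on the hard instances. -/
noncomputable def Protocol.message (A : Protocol Ω b n m d) (ω : Ω) (t : ℕ)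
    (s : ℕ → Message b) (y : Fin n → (Fin d × Fin d) × Bool) : Message b :=
  if h : t < m then A.msg ⟨t, h⟩ ω (fun k => instVec (y k)) fun i => s i
  else Classical.arbitrary _

/-- The state is a sequence indexed by ℕ, so that its type does not depend on the round; round t
overwrites entry t and leaves the earlier messages intact. -/
theorem Protocol.transcript_eq_run (A : Protocol Ω b n m d) (ω : Ω) (s : ℕ → Message b)
    (X : Fin m → Fin n → (Fin d × Fin d) × Bool) (t : ℕ) (ht : t ≤ m) :
    A.transcript ω (fun t k => instVec (X t k)) t ht = fun i : Fin t =>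
      run (fun t s y => Function.update s t (A.message ω t s y)) 0 s t
        (fun k => X (Fin.castLE ht k)) i := by
  induction t with
  | zero => funext i; exact i.elim0
  | succ t ih =>
    have ih := ih (Nat.le_of_succ_le ht)
    have hrun : (Fin.init fun k : Fin (t + 1) => X (Fin.castLE ht k)) =
        fun k => X (Fin.castLE (Nat.le_of_succ_le ht) k) := rfl
    funext i
    refine Fin.lastCases ?_ (fun i => ?_) i
    · simp only [Protocol.transcript, Fin.snoc_last, run, hrun, zero_add, Fin.val_last,
        Function.update_self]
      rw [ih, Protocol.message, dif_pos (Nat.lt_of_succ_le ht)]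
      rfl
    · simp only [Protocol.transcript, Fin.snoc_castSucc, run, hrun, zero_add, Fin.val_castSucc]
      rw [Function.update_of_ne i.2.ne, ih]

theorem Protocol.sum_success_le (A : Protocol Ω b n m d) {ρ K : ℝ} (hρ₀ : 0 ≤ ρ) (hρ₁ : ρ ≤ 1)
    (hρK : ρ * K ≤ 1 / 4) (hK : (d : ℝ) ^ 2 * Real.exp (-K) ≤ 1) (hn : n ≤ d * d) (hd : 0 < d)
    (ω : Ω) (P : Finset (Fin d × Fin d)) :
    ∑ p ∈ P, (Measure.pi fun _ : Fin m => iidLaw (hardLaw ρ p) n).real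
        {X | (ω, X) ∈ {z : Ω × (Fin m → Sample n d) | A.estimate z.1 z.2 = p}} ≤
      1 + 11 * Real.sqrt ((d : ℝ) ^ 2 * m * b) := by
  have : Nonempty (Fin d × Fin d) := ⟨(⟨0, hd⟩, ⟨0, hd⟩)⟩
  let s₀ : ℕ → Message b := fun _ => Classical.arbitrary _
  let out : (ℕ → Message b) → Fin d × Fin d := fun s => A.out ω fun i : Fin m => s i
  have hchain : ∀ p, (Measure.pi fun _ : Fin m => iidLaw (hardLaw ρ p) n).real
      {X | (ω, X) ∈ {z : Ω × (Fin m → Sample n d) | A.estimate z.1 z.2 = p}} =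
      evolve (fun t s y => Function.update s t (A.message ω t s y)) (batchWeight ρ p) 0 m
        (fun s => if out s = p then 1 else 0) s₀ := by
    intro p
    have hmeas : MeasurableSet
        {X | (ω, X) ∈ {z : Ω × (Fin m → Sample n d) | A.estimate z.1 z.2 = p}} :=
      measurable_prodMk_left (A.measurable_estimate (measurableSet_singleton p))
    rw [pi_iidLaw_hardLaw hρ₀ hρ₁, map_finLaw_real (fun X => Finset.prod_nonneg fun t _ =>
      batchWeight_nonneg hρ₀ hρ₁ p _) (measurable_of_finite _) hmeas, evolve_eq_sum]
    refine Finset.sum_congr rfl fun X _ => ?_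
    have : A.estimate ω (fun t k => instVec (X t k)) = out (run (fun t s y =>
        Function.update s t (A.message ω t s y)) 0 s₀ m X) := by
      rw [Protocol.estimate, A.transcript_eq_run ω s₀]
      rfl
    simp only [Set.mem_ofPred_eq, this]
  simp only [hchain]
  refine (Finset.sum_le_sum_of_subset_of_nonneg (Finset.subset_univ P) fun p _ _ =>
    evolve_indicator_nonneg _ (batchWeight_nonneg hρ₀ hρ₁ p) 0 m out p s₀).trans ?_
  have := sum_evolve_message_le (D := Fin d × Fin d) (α := Fin n) hρ₀ hρ₁ hρK
    (by simpa [← sq] using hK) (by simpa using hn)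
    (A.message ω) (fun t s w => Function.update s t w) out m s₀
  simpa [← sq] using this

theorem OnlineProtocol.success_eq_evolve (A : OnlineProtocol Ω b m d) {ρ : ℝ} (hρ₀ : 0 ≤ ρ)
    (hρ₁ : ρ ≤ 1) (ω : Ω) (p : Fin d × Fin d) :
    (iidLaw (hardLaw ρ p) m).real
        {x | (ω, x) ∈ {z : Ω × Sample m d | A.estimate z.1 z.2 = p}} =
      evolve (fun t w e => if h : t < m then A.update ⟨t, h⟩ ω (instVec e) w else w)
        (instWeight ρ p) 0 m (fun w => if A.out ω w = p then 1 else 0) (A.init ω) := by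
  have hmeas : MeasurableSet {x | (ω, x) ∈ {z : Ω × Sample m d | A.estimate z.1 z.2 = p}} :=
    measurable_prodMk_left (A.measurable_estimate (measurableSet_singleton p))
  rw [iidLaw_hardLaw hρ₀ hρ₁, map_finLaw_real (batchWeight_nonneg hρ₀ hρ₁ p)
    (measurable_of_finite _) hmeas, evolve_eq_sum]
  refine Finset.sum_congr rfl fun X _ => ?_
  have : A.estimate ω (fun t => instVec (X t)) = A.out ω (run (fun t w e =>
      if h : t < m then A.update ⟨t, h⟩ ω (instVec e) w else w) 0 (A.init ω) m X) := by
    rw [OnlineProtocol.estimate, ← foldl_eq_run]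
    simp
  simp only [Set.mem_ofPred_eq, this, batchWeight]

/-- The whole sample is a single batch, so `sum_batch_le` applies with no use of the memory bound:
3/2 + 8 ≤ 10. -/
theorem OnlineProtocol.sum_success_le_of_lt (A : OnlineProtocol Ω b m d) {ρ K : ℝ} (hρ₀ : 0 ≤ ρ)
    (hρ₁ : ρ ≤ 1) (hρK : ρ * K ≤ 1 / 4) (hK : (d : ℝ) ^ 2 * Real.exp (-K) ≤ 1)
    (hm : m ≤ d * d) (hd : 0 < d) (ω : Ω) (P : Finset (Fin d × Fin d)) :
    ∑ p ∈ P, (iidLaw (hardLaw ρ p) m).real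
        {x | (ω, x) ∈ {z : Ω × Sample m d | A.estimate z.1 z.2 = p}} ≤ 10 := by
  have : Nonempty (Fin d × Fin d) := ⟨(⟨0, hd⟩, ⟨0, hd⟩)⟩
  refine (Finset.sum_le_sum_of_subset_of_nonneg (Finset.subset_univ P) fun p _ _ =>
    measureReal_nonneg).trans ?_
  simp only [A.success_eq_evolve hρ₀ hρ₁, evolve_eq_sum]
  refine (sum_batch_le (D := Fin d × Fin d) (α := Fin m) hρ₀ hρ₁ hρK (by simpa using hm)
    fun X => A.out ω (run _ 0 (A.init ω) m X)).trans ?_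
  simp only [Fintype.card_prod, Fintype.card_fin]
  push_cast
  nlinarith

theorem OnlineProtocol.sum_success_le (A : OnlineProtocol Ω b m d) {ρ K : ℝ} (hρ₀ : 0 ≤ ρ)
    (hρ₁ : ρ ≤ 1) (hρK : ρ * K ≤ 1 / 4) (hK : (d : ℝ) ^ 2 * Real.exp (-K) ≤ 1)
    (hm : d * d ≤ m) (hd : 0 < d) (ω : Ω) (P : Finset (Fin d × Fin d)) :
    ∑ p ∈ P, (iidLaw (hardLaw ρ p) m).real
        {x | (ω, x) ∈ {z : Ω × Sample m d | A.estimate z.1 z.2 = p}} ≤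
      1 + 11 * Real.sqrt (2 * (m * b)) := by
  have : Nonempty (Fin d × Fin d) := ⟨(⟨0, hd⟩, ⟨0, hd⟩)⟩
  refine (Finset.sum_le_sum_of_subset_of_nonneg (Finset.subset_univ P) fun p _ _ =>
    measureReal_nonneg).trans ?_
  have hdd : 0 < d * d := Nat.mul_pos hd hd
  -- The time m is padded with idle steps to a multiple of d²; as d² ≤ m, this at most doubles it.
  obtain ⟨k, hk⟩ : ∃ k, (m / (d * d) + 1) * (d * d) = m + k :=
    Nat.exists_eq_add_of_le (by
      have := Nat.lt_div_mul_add (a := m) hdd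
      rw [add_mul, one_mul]; omega)
  have hk' : m + k ≤ 2 * m := by
    have := Nat.div_mul_le_self m (d * d)
    rw [← hk, add_mul, one_mul]
    omega
  set M := m / (d * d) + 1 with hM
  set F : ℕ → Message b → (Fin d × Fin d) × Bool → Message b := fun t w e =>
    if h : t < m then A.update ⟨t, h⟩ ω (instVec e) w else w with hF
  have hchain : ∀ p, evolve F (instWeight ρ p) 0 m (fun w => if A.out ω w = p then 1 else 0) =
      evolve (fun t w (X : Fin (d * d) → (Fin d × Fin d) × Bool) => run F (t * (d * d)) w (d * d) X)
        (batchWeight ρ p) 0 M (fun w => if A.out ω w = p then 1 else 0) := by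
    intro p
    rw [← evolve_idle F (sum_instWeight ρ p) m k, ← hk]
    · exact (evolve_batch F (instWeight ρ p) (d * d) M _).symm
    · intro t ht s y
      simp only [hF, dif_neg ht.not_gt]
  simp only [A.success_eq_evolve hρ₀ hρ₁, ← hF, hchain]
  refine (sum_evolve_message_le (D := Fin d × Fin d) (α := Fin (d * d)) hρ₀ hρ₁ hρK
    (by simpa [← sq] using hK) (by simp)
    (fun t w X => run F (t * (d * d)) w (d * d) X) (fun _ _ w => w) (A.out ω) M
    (A.init ω)).trans ?_
  refine add_le_add le_rfl (mul_le_mul_of_nonneg_left (Real.sqrt_le_sqrt ?_) (by norm_num))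
  have h1 : ((M * (d * d) : ℕ) : ℝ) ≤ ((2 * m : ℕ) : ℝ) := by exact_mod_cast hk ▸ hk'
  simp only [Fintype.card_prod, Fintype.card_fin]
  push_cast at h1 ⊢
  nlinarith [mul_le_mul_of_nonneg_right h1 (Nat.cast_nonneg (α := ℝ) b)]

end Reduction

end SparsePCA

/-! ### Choice of parameters and conclusion -/

theorem mainTheorem3 :
    -- the plug-in estimator succeeds
    (∀ d : ℕ, 9 ≤ d → ∀ (m : ℕ) (P : Measure (Fin d → ℝ)) (τ : ℝ) (p : Fin d × Fin d),
      SparsePCA.IsPairCorrelated P τ p → SparsePCA.Concentrates m P τ →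
      ∀ est : SparsePCA.Sample m d → Fin d × Fin d, SparsePCA.IsPlugIn est →
        1 - (d : ℝ) ^ 2 * Real.exp (-((m : ℝ) * τ ^ 2 / 6)) ≤
          (SparsePCA.iidLaw P m).real {x | est x = p}) ∧
    -- in particular, for a bias of order `1 / (d log d)`
    (∀ c₁ c₂ : ℝ, 0 < c₁ → 0 < c₂ → ∃ κ : ℝ, 0 < κ ∧
      ∀ d : ℕ, 9 ≤ d → ∀ (m : ℕ) (P : Measure (Fin d → ℝ)) (τ : ℝ) (p : Fin d × Fin d),
        SparsePCA.IsPairCorrelated P τ p → SparsePCA.Concentrates m P τ →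
        SparsePCA.BiasOfOrder c₁ c₂ d τ →
        ∀ est : SparsePCA.Sample m d → Fin d × Fin d, SparsePCA.IsPlugIn est →
          1 - (d : ℝ) ^ 2 * Real.exp (-(κ * ((m : ℝ) / ((d : ℝ) ^ 2 * Real.log d ^ 2)))) ≤
            (SparsePCA.iidLaw P m).real {x | est x = p}) ∧
    -- information-constrained protocols fail
    (∃ c₁ c₂ C : ℝ, 0 < c₁ ∧ 0 < c₂ ∧ 0 < C ∧
      ∀ d : ℕ, 9 ≤ d → ∃ τ : ℝ, SparsePCA.BiasOfOrder c₁ c₂ d τ ∧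
        ∀ (b m : ℕ) (Ω : Type u) [MeasurableSpace Ω] (ν : Measure Ω) [IsProbabilityMeasure ν],
          (∀ A : SparsePCA.OnlineProtocol Ω b m d,
            ∃ (P : Measure (Fin d → ℝ)) (p : Fin d × Fin d),
              SparsePCA.IsPairCorrelated P τ p ∧ (∀ k, SparsePCA.Concentrates k P τ) ∧
              A.successProb ν P p ≤
                C * (1 / (d : ℝ) ^ 2 + Real.sqrt ((m : ℝ) * b / (d : ℝ) ^ 4))) ∧
          (∀ A : SparsePCA.Protocol Ω b (d * (d - 1)) (m / (d * (d - 1))) d,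
            ∃ (P : Measure (Fin d → ℝ)) (p : Fin d × Fin d),
              SparsePCA.IsPairCorrelated P τ p ∧ (∀ k, SparsePCA.Concentrates k P τ) ∧
              A.successProb ν P p ≤
                C * (1 / (d : ℝ) ^ 2 + Real.sqrt ((m : ℝ) * b / (d : ℝ) ^ 4)))) := by
  refine ⟨fun d _ m P τ p h hc est hest => SparsePCA.plugIn_success h hc hest,
    fun c₁ c₂ hc₁ _ => ⟨c₁ ^ 2 / 6, by positivity, fun d hd m P τ p h hc hτ est hest =>
      SparsePCA.plugIn_success_of_biasOfOrder hc₁ hd h hc hτ hest⟩, ?_⟩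
  open SparsePCA in
    -- Here τ is exactly 1/(16 d log d), so one constant serves on both sides; 100 = 25 · 4, as
    -- there are at least d²/4 pairs and the sum of the success probabilities is at most 25 +
    -- 25√(mb).
    refine ⟨1 / 16, 1 / 16, 100, by norm_num, by norm_num, by norm_num, fun d hd => ?_⟩
    have hd0 : 0 < d := by omega
    have hd9 : (9 : ℝ) ≤ d := by exact_mod_cast hd
    have hlog : 1 ≤ Real.log d := by
      rw [Real.le_log_iff_exp_le (by linarith)]
      linarith [Real.exp_one_lt_d9]
    -- `K` is the least threshold with d² e^{-K} ≤ 1, and `ρ` is then the largest bias with ρK ≤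
    -- 1/4.
    set ρ : ℝ := 1 / (8 * Real.log d) with hρ
    set K : ℝ := 2 * Real.log d with hK
    have hρ₀ : 0 < ρ := by positivity
    have hρ₁ : ρ ≤ 1 := by rw [hρ, div_le_one (by positivity)]; linarith
    have hρK : ρ * K ≤ 1 / 4 := by rw [hρ, hK]; apply le_of_eq; field_simp; norm_num
    have hexp : (d : ℝ) ^ 2 * Real.exp (-K) ≤ 1 := by
      have : Real.exp K = (d : ℝ) ^ 2 := by
        rw [hK, show 2 * Real.log d = ((2 : ℕ) : ℝ) * Real.log d by norm_num, Real.exp_nat_mul,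
          Real.exp_log (by linarith)]
      rw [← this, ← Real.exp_add, add_neg_cancel, Real.exp_zero]
    set τ : ℝ := ρ / (2 * d) with hτ
    have hτ' : τ = 1 / 16 / (d * Real.log d) := by
      rw [hτ, hρ]; field_simp; norm_num
    refine ⟨τ, ⟨hτ'.ge, hτ'.le⟩, fun b m Ω _ ν _ => ?_⟩
    set pairs := Finset.univ.filter fun p : Fin d × Fin d => p.1 < p.2 with hpairs
    have hcard : (d : ℝ) ^ 2 / 4 ≤ pairs.card := by
      have h1 := two_mul_card_pairs d
      have h2 : 2 * (pairs.card : ℝ) + d = d * d := by exact_mod_cast h1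
      nlinarith
    have hne : pairs.Nonempty := by
      rw [← Finset.card_pos]
      have : (0 : ℝ) < pairs.card := lt_of_lt_of_le (by positivity) hcard
      exact_mod_cast this
    have hroot : Real.sqrt ((m : ℝ) * b / (d : ℝ) ^ 4) = Real.sqrt (m * b) / d ^ 2 := by
      rw [Real.sqrt_div (by positivity), show (d : ℝ) ^ 4 = (d ^ 2) ^ 2 by ring,
        Real.sqrt_sq (by positivity)]
    have hfin : ∀ c : ℝ, c ≤ 25 + 25 * Real.sqrt (m * b) → c / pairs.card ≤
        100 * (1 / (d : ℝ) ^ 2 + Real.sqrt ((m : ℝ) * b / (d : ℝ) ^ 4)) := by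
      intro c hc
      have hs := Real.sqrt_nonneg ((m : ℝ) * b)
      rw [hroot, div_le_iff₀ (lt_of_lt_of_le (by positivity) hcard)]
      calc c ≤ 100 * (1 / (d : ℝ) ^ 2 + Real.sqrt (m * b) / d ^ 2) * (d ^ 2 / 4) := by
            refine hc.trans (le_of_eq ?_); field_simp; ring
        _ ≤ _ := by gcongr
    have hsqrt2 : Real.sqrt (2 * ((m : ℝ) * b)) ≤ 2 * Real.sqrt (m * b) := by
      rw [Real.sqrt_mul (by norm_num)]
      refine mul_le_mul_of_nonneg_right ?_ (Real.sqrt_nonneg _)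
      exact Real.sqrt_le_iff.2 ⟨by norm_num, by norm_num⟩
    have hgood : ∀ p ∈ pairs, IsPairCorrelated (hardLaw ρ p) τ p ∧
        ∀ k, Concentrates k (hardLaw ρ p) τ := fun p hp =>
      ⟨isPairCorrelated_hardLaw hρ₀ hρ₁ (by simpa [hpairs] using hp),
        concentrates_hardLaw hρ₀ hρ₁⟩
    have hprob := fun p => isProbabilityMeasure_hardLaw (d := d) hρ₀.le hρ₁ p
    have hs := Real.sqrt_nonneg ((m : ℝ) * b)
    refine ⟨fun A => ?_, fun A => ?_⟩
    · obtain ⟨p, hp, hle⟩ := exists_prod_real_le ν pairs hne (fun p => iidLaw (hardLaw ρ p) m)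
        (fun p => {z | A.estimate z.1 z.2 = p})
        (fun p => A.measurable_estimate (measurableSet_singleton p))
        (c := 25 + 25 * Real.sqrt (m * b)) fun ω => by
          rcases le_total m (d * d) with hm | hm
          · have := A.sum_success_le_of_lt hρ₀.le hρ₁ hρK hexp hm hd0 ω pairs
            linarith
          · have := A.sum_success_le hρ₀.le hρ₁ hρK hexp hm hd0 ω pairs
            linarith
      exact ⟨hardLaw ρ p, p, (hgood p hp).1, (hgood p hp).2, hle.trans (hfin _ le_rfl)⟩
    · obtain ⟨p, hp, hle⟩ := exists_prod_real_le ν pairs hne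
        (fun p => Measure.pi fun _ : Fin (m / (d * (d - 1))) =>
          iidLaw (hardLaw ρ p) (d * (d - 1)))
        (fun p => {z | A.estimate z.1 z.2 = p})
        (fun p => A.measurable_estimate (measurableSet_singleton p))
        (c := 25 + 25 * Real.sqrt (m * b)) fun ω => by
          have := A.sum_success_le hρ₀.le hρ₁ hρK hexp (Nat.mul_le_mul_left d (Nat.sub_le d 1)) hd0 ω
            pairs
          refine this.trans ?_
          -- Batches have d(d-1) instances rather than d²; since d² ≤ 2d(d-1), this costs a factor
          -- 2.
          have hM : (d : ℝ) ^ 2 * (m / (d * (d - 1)) : ℕ) ≤ 2 * m := by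
            have h1 : ((m / (d * (d - 1)) * (d * (d - 1)) : ℕ) : ℝ) ≤ m := by
              exact_mod_cast Nat.div_mul_le_self _ _
            rw [Nat.cast_mul, Nat.cast_mul, Nat.cast_sub (by omega), Nat.cast_one] at h1
            have h2 : (d : ℝ) ^ 2 ≤ 2 * (d * (d - 1)) := by nlinarith
            have := mul_le_mul_of_nonneg_right h2
              (Nat.cast_nonneg (α := ℝ) (m / (d * (d - 1))))
            linarith
          have : Real.sqrt ((d : ℝ) ^ 2 * (m / (d * (d - 1)) : ℕ) * b) ≤
              Real.sqrt (2 * (m * b)) := by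
            refine Real.sqrt_le_sqrt ?_
            have := mul_le_mul_of_nonneg_right hM (Nat.cast_nonneg (α := ℝ) b)
            linarith
          linarith
      exact ⟨hardLaw ρ p, p, (hgood p hp).1, (hgood p hp).2, hle.trans (hfin _ le_rfl)⟩
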